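/- **Setting.** Let $T\colon[0,1]\to[0,1]$ be a $C^4$ map with $T(0)=T(1)=0$ that, for some $c\in(0,1)$, is strictly increasing on $[0,c]$ and strictly decreasing on $[c,1]$, with $\Delta:=T(c)<1$. Put $\Gamma:=1-\Delta$ and $I:=[-\Gamma,1]$, and extend $T$ to $I$ so that $T$ is continuous on $I$ and is $C^4$, positive and strictly decreasing on $[-\Gamma,0)$, with $T(-\Gamma)<\Delta$. Let $s\colon I\to[0,\Gamma/2]$ satisfy: $s(x)=0$ for $x\le 0$; $s$ is continuous on $(0,1)$ and $0<s(x)<\Gamma/2$ there; $T(x)-s(x)>0$ for $x\in(0,1-\Gamma/2]$; and $T(x)-s(x)>x$ for all sufficiently small $x>0$. For each $x\in(0,1]$ with $s(x)>0$ let $g_x$ be a probability density on $\mathbb R$ that vanishes outside $[-s(x),s(x)]$, jointly measurable in $(x,y)$, such that $\sup_{x\in[\epsilon,1-\epsilon]}|g_x|_{TV}<\infty$ for every $\epsilon>0$, where $|\cdot|_{TV}$ is the total variation on $\mathbb R$. Consider the Markov chain on $I$ that moves from $x$ to $T(x)+Y$, where $Y$ has density $g_x$ if $s(x)>0$, and $Y=0$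 if $s(x)=0$; let $P_x$ be its transition probabilities. A probability measure $\mu$ on $I$ is stationary if $\int P_x\,d\mu(x)=\mu$; it is ergodic if the shift on $I^{\mathbb N}$ is ergodic for the law $\mathbb P_\mu$ of the chain started from $\mu$. **Theorem.** The set of ergodic stationary probability measures with a density (with respect to Lebesgue measure) of bounded variation is finite and non-empty. If $\mu_1\neq\mu_2$ are two such measures, with densities $h_1,h_2$, then $\{h_1\ne0\}\cap\{h_2\neq0\}$ is Lebesgue-null; if moreover for every $x\in(0,1)$ the support of the measure $g_x(y)\,dy$ is the whole interval $[-s(x),s(x)]$, then also the topological supports satisfy $\mathrm{Leb}(\operatorname{supp}\mu_1\cap\operatorname{supp}\mu_2)=0$. Finally, there is $\varepsilon>0$ such that $\operatorname{supp}\mu\subset[\varepsilon,1-\Gamma/2]$ for every such measure $\mu$. -/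

import Mathlib

open MeasureTheory ProbabilityTheory Set
open scoped ENNReal NNReal

/-- `T` restricted to `[0, 1]` is a unimodal map of class `C⁴` with turning point `c`, with
`T 0 = T 1 = 0` and with maximal value `T c < 1`. (Then `T c > 0` and `T' c = 0`.) -/
structure IsUnimodalMap (T : ℝ → ℝ) (c : ℝ) : Prop where
  c_mem : c ∈ Ioo (0 : ℝ) 1
  mapsTo : MapsTo T (Icc 0 1) (Icc 0 1)
  contDiffOn : ContDiffOn ℝ 4 T (Icc 0 1)
  map_zero : T 0 = 0
  map_one : T 1 = 0
  strictMonoOn : StrictMonoOn T (Icc 0 c)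
  strictAntiOn : StrictAntiOn T (Icc c 1)
  max_lt_one : T c < 1

/-- The gap `Γ = 1 - T c` between the maximal value of `T` and `1`. -/
def unimodalGap (T : ℝ → ℝ) (c : ℝ) : ℝ := 1 - T c

/-- The data of a unimodal map `T`, extended to `[-Γ, 1]`, with compactly supported additive
heteroscedastic noise: at the state `x` the noise has the probability density `g x`, supported
in `[-s x, s x]`; where `s x = 0` there is no noise. Only the values of `T` and `s` on `[-Γ, 1]`
and of `g` on `(0, 1] × ℝ` matter. -/
structure NoisyUnimodalMap where
  T : ℝ → ℝ
  c : ℝ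
  s : ℝ → ℝ
  g : ℝ → ℝ → ℝ
  unimodal : IsUnimodalMap T c
  /- the extension of `T` to `[-Γ, 0)` -/
  continuousOn : ContinuousOn T (Icc (-unimodalGap T c) 1)
  contDiffOn_neg : ContDiffOn ℝ 4 T (Ico (-unimodalGap T c) 0)
  pos_of_neg : ∀ x ∈ Ico (-unimodalGap T c) 0, 0 < T x
  strictAntiOn_neg : StrictAntiOn T (Ico (-unimodalGap T c) 0)
  map_left_lt : T (-unimodalGap T c) < T c
  /- the noise amplitude -/
  s_nonpos : ∀ x ∈ Icc (-unimodalGap T c) 0, s x = 0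
  s_mem : ∀ x ∈ Ioo (0 : ℝ) 1, 0 < s x ∧ s x < unimodalGap T c / 2
  s_one : 0 ≤ s 1 ∧ s 1 ≤ unimodalGap T c / 2
  s_continuousOn : ContinuousOn s (Ioo 0 1)
  sub_pos : ∀ x ∈ Ioc 0 (1 - unimodalGap T c / 2), 0 < T x - s x
  sub_gt_near_zero : ∃ δ > 0, ∀ x ∈ Ioo 0 δ, x < T x - s x
  /- the noise densities -/
  g_measurable : Measurable (Function.uncurry g)
  g_nonneg : ∀ x ∈ Ioc (0 : ℝ) 1, 0 < s x → ∀ y, 0 ≤ g x y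
  g_integral : ∀ x ∈ Ioc (0 : ℝ) 1, 0 < s x → ∫ y, g x y = 1
  g_support : ∀ x ∈ Ioc (0 : ℝ) 1, 0 < s x → ∀ y ∉ Icc (-s x) (s x), g x y = 0
  g_variation : ∀ ε > 0, ∃ C : ℝ≥0, ∀ x ∈ Icc ε (1 - ε), eVariationOn (g x) univ ≤ C

namespace NoisyUnimodalMap

variable (M : NoisyUnimodalMap)

/-- `Γ = 1 - T c`. -/
def gap : ℝ := unimodalGap M.T M.c

/-- The state space `I = [-Γ, 1]`. -/
def stateSet : Set ℝ := Icc (-M.gap) 1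

/-- The state space `I = [-Γ, 1]` as a type. -/
abbrev State : Type := M.stateSet

/-- Lebesgue measure on the state space. -/
noncomputable def leb : Measure M.State := Measure.comap Subtype.val volume

lemma measurableSet_stateSet : MeasurableSet M.stateSet := measurableSet_Icc

lemma T_c_nonneg : 0 ≤ M.T M.c :=
  (M.unimodal.mapsTo ⟨M.unimodal.c_mem.1.le, M.unimodal.c_mem.2.le⟩).1

lemma gap_pos : 0 < M.gap := by
  have := M.unimodal.max_lt_one
  unfold gap unimodalGap; linarith

lemma T_le_of_unit {x : ℝ} (hx : x ∈ Icc (0 : ℝ) 1) : M.T x ≤ M.T M.c := by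
  have hc := M.unimodal.c_mem
  rcases le_total x M.c with h | h
  · exact M.unimodal.strictMonoOn.monotoneOn ⟨hx.1, h⟩ ⟨hc.1.le, le_rfl⟩ h
  · exact M.unimodal.strictAntiOn.antitoneOn ⟨le_rfl, hc.2.le⟩ ⟨h, hx.2⟩ h

lemma T_mem_stateSet {x : ℝ} (hx : x ∈ M.stateSet) : M.T x ∈ M.stateSet := by
  have hgap := M.gap_pos
  have hlt := M.unimodal.max_lt_one
  rcases lt_or_ge x 0 with h | h
  · have hx' : x ∈ Ico (-unimodalGap M.T M.c) 0 := ⟨hx.1, h⟩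
    have h0 := M.pos_of_neg x hx'
    have h1 := M.strictAntiOn_neg.antitoneOn ⟨le_rfl, hx'.1.trans_lt h⟩ hx' hx'.1
    have h2 := M.map_left_lt
    constructor <;> linarith
  · have := M.unimodal.mapsTo (show x ∈ Icc (0 : ℝ) 1 from ⟨h, hx.2⟩)
    exact ⟨by linarith [this.1], this.2⟩

/-- Where there is noise, the state is in `(0, 1]`. -/
lemma mem_Ioc_of_s_pos {x : ℝ} (hx : x ∈ M.stateSet) (hs : 0 < M.s x) : x ∈ Ioc (0 : ℝ) 1 := by
  refine ⟨?_, hx.2⟩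
  by_contra h
  exact hs.ne' (M.s_nonpos x ⟨hx.1, not_lt.mp h⟩)

lemma s_le {x : ℝ} (hx : x ∈ Ioc (0 : ℝ) 1) : M.s x ≤ M.gap / 2 := by
  rcases hx.2.lt_or_eq with h | h
  · exact (M.s_mem x ⟨hx.1, h⟩).2.le
  · rw [h]; exact M.s_one.2

lemma measurable_T : Measurable fun x : M.State => M.T x :=
  (continuousOn_iff_continuous_domRestrict.mp M.continuousOn).measurable

lemma measurableSet_noisy : MeasurableSet {x : M.State | 0 < M.s x} := by
  have h : {x : M.State | 0 < M.s x} =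
      (Subtype.val ⁻¹' Ioo (0 : ℝ) 1) ∪ (Subtype.val ⁻¹' {y : ℝ | y = 1 ∧ 0 < M.s 1}) := by
    ext x
    simp only [mem_ofPred_eq, mem_union, mem_preimage]
    constructor
    · intro hs
      have hx := M.mem_Ioc_of_s_pos x.2 hs
      rcases hx.2.lt_or_eq with h | h
      · exact Or.inl ⟨hx.1, h⟩
      · exact Or.inr ⟨h, h ▸ hs⟩
    · rintro (h | ⟨h, hs⟩)
      · exact (M.s_mem x h).1
      · rw [h]; exact hs
  rw [h]
  refine (measurable_subtype_coe measurableSet_Ioo).union (measurable_subtype_coe ?_)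
  by_cases hs : 0 < M.s 1 <;> simp [hs]

/-- The stochastic kernel `p (x, y) = g x (y - T x)`. -/
def density (x : M.State) (y : ℝ) : ℝ≥0∞ := ENNReal.ofReal (M.g x (y - M.T x))

lemma measurable_density : Measurable (Function.uncurry M.density) := by
  have h : Measurable fun z : M.State × ℝ => ((z.1 : ℝ), z.2 - M.T z.1) :=
    (measurable_subtype_coe.comp measurable_fst).prodMk
      (measurable_snd.sub (M.measurable_T.comp measurable_fst))
  exact (M.g_measurable.comp h).ennreal_ofReal

open Classical in
/-- The transition probabilities, as probability measures on `ℝ`: the law of `T x + Y`, where `Y`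
has density `g x`, that is, the measure with density `p (x, ·)`, if `s x > 0`; and the Dirac mass
at `T x` if `s x = 0`. -/
noncomputable def transitionReal : Kernel M.State ℝ :=
  Kernel.piecewise M.measurableSet_noisy
    (Kernel.withDensity (Kernel.const _ volume) M.density)
    (Kernel.deterministic (fun x : M.State => M.T x) M.measurable_T)

lemma transitionReal_of_pos {x : M.State} (hs : 0 < M.s x) :
    M.transitionReal x = volume.withDensity (M.density x) := by
  rw [transitionReal, Kernel.piecewise_apply, if_pos (show x ∈ {x : M.State | 0 < M.s x} from hs),
    Kernel.withDensity_apply _ M.measurable_density, Kernel.const_apply]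

lemma transitionReal_of_not_pos {x : M.State} (hs : ¬ 0 < M.s x) :
    M.transitionReal x = Measure.dirac (M.T x) := by
  rw [transitionReal, Kernel.piecewise_apply,
    if_neg (show x ∉ {x : M.State | 0 < M.s x} from hs), Kernel.deterministic_apply]

instance : IsMarkovKernel M.transitionReal := by
  refine ⟨fun x => ⟨?_⟩⟩
  by_cases hs : 0 < M.s x
  · have hx := M.mem_Ioc_of_s_pos x.2 hs
    have hint : Integrable (M.g x) := by
      by_contra h
      have := M.g_integral x hx hs
      rw [integral_undef h] at this
      exact zero_ne_one this
    rw [M.transitionReal_of_pos hs, withDensity_apply _ MeasurableSet.univ, Measure.restrict_univ]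
    have h1 : ∫⁻ y, M.density x y = ∫⁻ y, ENNReal.ofReal (M.g x y) := by
      simp only [density]
      exact lintegral_sub_right_eq_self (fun y => ENNReal.ofReal (M.g x y)) (M.T x)
    rw [h1, ← ofReal_integral_eq_lintegral_ofReal hint
      (Filter.Eventually.of_forall (M.g_nonneg x hx hs)), M.g_integral x hx hs, ENNReal.ofReal_one]
  · rw [M.transitionReal_of_not_pos hs]; simp

/-- The chain does not leave the state space. -/
lemma transitionReal_compl (x : M.State) : M.transitionReal x M.stateSetᶜ = 0 := by
  have hT := M.T_mem_stateSet x.2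
  by_cases hs : 0 < M.s x
  · have hx := M.mem_Ioc_of_s_pos x.2 hs
    rw [M.transitionReal_of_pos hs, withDensity_apply _ M.measurableSet_stateSet.compl]
    refine setLIntegral_eq_zero M.measurableSet_stateSet.compl ?_
    intro y hy
    simp only [density, Pi.zero_apply]
    rw [M.g_support x hx hs, ENNReal.ofReal_zero]
    intro hmem
    apply hy
    have h0 := (M.unimodal.mapsTo (show (x : ℝ) ∈ Icc (0 : ℝ) 1 from ⟨hx.1.le, hx.2⟩)).1
    have h1 := M.T_le_of_unit (show (x : ℝ) ∈ Icc (0 : ℝ) 1 from ⟨hx.1.le, hx.2⟩)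
    have h2 := M.s_le hx
    have h3 := M.gap_pos
    have h4 : M.gap = 1 - M.T M.c := rfl
    exact ⟨by linarith [hmem.1], by linarith [hmem.2]⟩
  · rw [M.transitionReal_of_not_pos hs, Measure.dirac_apply' _ M.measurableSet_stateSet.compl]
    simp [hT]

/-- The transition probabilities `P_x` of the chain, as a Markov kernel on the state space. -/
noncomputable def transition : Kernel M.State M.State :=
  Kernel.comapRight M.transitionReal (MeasurableEmbedding.subtype_coe M.measurableSet_stateSet)

instance : IsMarkovKernel M.transition := by
  refine Kernel.IsMarkovKernel.comapRight _ _ fun x => ?_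
  rw [Subtype.range_coe]
  exact (prob_compl_eq_zero_iff M.measurableSet_stateSet).mp (M.transitionReal_compl x)

/-- The law `ℙ_μ` on the space of sequences of states of the chain with initial law `μ`. -/
noncomputable def pathLaw (μ : Measure M.State) : Measure (ℕ → M.State) :=
  Kernel.trajMeasure (X := fun _ => M.State) μ fun n =>
    M.transition.comap (fun h : (Finset.Iic n → M.State) => h ⟨n, Finset.mem_Iic.mpr le_rfl⟩)
      (measurable_pi_apply _)

/-- The shift on the space of sequences of states. -/
def shift (ω : ℕ → M.State) : ℕ → M.State := fun t => ω (t + 1)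

/-- `h` is a density of `μ`, with respect to Lebesgue measure on the state space, that has bounded
variation. -/
def IsBVDensity (μ : Measure M.State) (h : M.State → ℝ) : Prop :=
  (∀ x, 0 ≤ h x) ∧ BoundedVariationOn h univ ∧
    μ = M.leb.withDensity fun x => ENNReal.ofReal (h x)

/-- The ergodic stationary probability measures of the chain that have a density in `BV`.
Stationary means `∫ P_x dμ(x) = μ`, and ergodic that the shift is ergodic for `ℙ_μ`. -/
def ergodicBV : Set (Measure M.State) :=
  {μ | IsProbabilityMeasure μ ∧ Kernel.Invariant M.transition μ ∧
    Ergodic M.shift (M.pathLaw μ) ∧ ∃ h, M.IsBVDensity μ h}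

/-- For every `x ∈ (0, 1)` the support of the noise is the whole of `[-s x, s x]`. -/
def FullNoise : Prop :=
  ∀ x ∈ Ioo (0 : ℝ) 1,
    (volume.withDensity fun y => ENNReal.ofReal (M.g x y)).support = Icc (-M.s x) (M.s x)

end NoisyUnimodalMap

/-! Away from the endpoints the noise smooths, and near them the dynamics pushes inwards. By
compactness there is a core `[a, 1 - Γ / 2]` inside `(0, 1)` that the chain does not leave. A
stationary measure without an atom at `0` lives on this core: almost every point of a short interval
next to `0` would have to stay in it, whereas points near its right end jump out
(`measure_compl_core`). On the core the noise densities are bounded by one constant `C`, so all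
transition probabilities are at most `C` times Lebesgue measure `m` there. This domination carries
the rest. It makes averages of iterates converge, along an ultrafilter and on every measurable set,
to an absolutely continuous invariant measure. It also forces every such probability measure to be
at most `C • m`, so that its carriers have measure at least `C⁻¹`. A carrier of nearly minimal
measure therefore cannot be split in two, which gives an extremal invariant measure
(`exists_extremal_of_le_smul`). Distinct ergodic measures are mutually singular, so their carriers
are disjoint up to null sets, and only finitely many fit. A stationary density is an average of
translates of noise densities, hence of bounded variation. Ergodicity is that of the shift on path
space. It is linked to extremality by the harmonic function `x ↦ ℙ_x(s)` of an invariant event `s`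
(`ergodic_of_extremal`, `eq_smul_of_ergodic`). With full noise, the support of a stationary measure
on the core is approached at each of its points by intervals in the support of length bounded below,
so only countably many points are not interior. At a common interior point the two densities, being
continuous off countable sets, would overlap. -/

section MarkovChain

/-! ### Path laws of a Markov chain and the Markov property. -/

variable {S : Type*} [MeasurableSpace S]

/-- The sequence that starts with `x` and goes on with `ω`. -/
def prepend (x : S) (ω : ℕ → S) : ℕ → S
  | 0 => x
  | n + 1 => ω n

lemma measurable_prepend : Measurable (Function.uncurry (prepend (S := S))) := by
  refine measurable_pi_lambda _ fun n => ?_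
  cases n with
  | zero => exact measurable_fst
  | succ n => exact (measurable_pi_apply n).comp measurable_snd

lemma measurable_prepend_left (x : S) : Measurable (prepend x) :=
  measurable_prepend.comp measurable_prodMk_left

lemma measurableSet_box (n : ℕ) (B : ℕ → Set S) (hB : ∀ i, MeasurableSet (B i)) :
    MeasurableSet {ω : ℕ → S | ∀ i < n, ω i ∈ B i} := by
  have : {ω : ℕ → S | ∀ i < n, ω i ∈ B i} = ⋂ i, ⋂ (_ : i < n), (fun ω => ω i) ⁻¹' B i := by
    ext ω; simp
  rw [this]
  exact MeasurableSet.iInter fun i => MeasurableSet.iInter fun _ => measurable_pi_apply i (hB i)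

/-- Finite measures on sequence space that agree on all finite-dimensional boxes are equal. -/
lemma Measure.ext_of_boxes {P Q : Measure (ℕ → S)} [IsFiniteMeasure P]
    (h : ∀ (n : ℕ) (B : ℕ → Set S), (∀ i, MeasurableSet (B i)) →
      P {ω | ∀ i < n, ω i ∈ B i} = Q {ω | ∀ i < n, ω i ∈ B i}) : P = Q := by
  have huniv : P univ = Q univ := by simpa using h 0 (fun _ => univ) fun _ => .univ
  refine ext_of_generate_finite
    {s | ∃ (n : ℕ) (B : ℕ → Set S), (∀ i, MeasurableSet (B i)) ∧ s = {ω | ∀ i < n, ω i ∈ B i}}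
    ?_ ?_ ?_ huniv
  · apply le_antisymm
    · refine iSup_le fun i => ?_
      rintro s ⟨t, ht, rfl⟩
      refine MeasurableSpace.measurableSet_generateFrom
        ⟨i + 1, Function.update (fun _ => univ) i t, fun j => ?_, ?_⟩
      · by_cases hj : j = i
        · subst hj; simpa using ht
        · simp [hj]
      · ext ω
        simp only [mem_preimage, mem_ofPred_eq]
        constructor
        · intro hω j _
          by_cases hj : j = i
          · subst hj; simpa using hω
          · simp [hj]
        · intro hω
          simpa using hω i (Nat.lt_succ_self i)
    · refine MeasurableSpace.generateFrom_le ?_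
      rintro s ⟨n, B, hB, rfl⟩
      exact measurableSet_box n B hB
  · rintro s ⟨n, B, hB, rfl⟩ t ⟨m, D, hD, rfl⟩ -
    refine ⟨max n m, fun i => (if i < n then B i else univ) ∩ (if i < m then D i else univ),
      fun i => ?_, ?_⟩
    · refine MeasurableSet.inter ?_ ?_ <;> split_ifs <;> simp [hB, hD]
    · ext ω
      simp only [mem_inter_iff, mem_ofPred_eq]
      constructor
      · rintro ⟨h1, h2⟩ i _
        constructor
        · split_ifs with hi
          · exact h1 i hi
          · trivial
        · split_ifs with hi
          · exact h2 i hi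
          · trivial
      · intro h
        refine ⟨fun i hi => ?_, fun i hi => ?_⟩
        · simpa [hi] using (h i (lt_max_of_lt_left hi)).1
        · simpa [hi] using (h i (lt_max_of_lt_right hi)).2
  · rintro s ⟨n, B, hB, rfl⟩
    exact h n B hB

lemma measure_box (P : Measure (ℕ → S)) (n : ℕ) (B : ℕ → Set S) (hB : ∀ i, MeasurableSet (B i)) :
    P {ω | ∀ i < n, ω i ∈ B i} =
      ∫⁻ ω, ∏ i ∈ Finset.range n, (B i).indicator (fun _ => (1 : ℝ≥0∞)) (ω i) ∂P := by
  rw [← lintegral_indicator_one (measurableSet_box n B hB)]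
  refine lintegral_congr fun ω => ?_
  classical
  simp only [indicator_apply, mem_ofPred_eq, Pi.one_apply]
  split_ifs with h
  · exact (Finset.prod_eq_one fun i hi => if_pos (h i (Finset.mem_range.mp hi))).symm
  · push Not at h
    obtain ⟨i, hi, hn⟩ := h
    exact (Finset.prod_eq_zero (Finset.mem_range.mpr hi) (if_neg hn)).symm

variable (κ : Kernel S S)

/-- The transition of the chain with kernel `κ`, as a function of the whole past. -/
noncomputable def pastKernel (n : ℕ) : Kernel (Finset.Iic n → S) S :=
  κ.comap (fun h : (Finset.Iic n → S) => h ⟨n, Finset.mem_Iic.mpr le_rfl⟩) (measurable_pi_apply _)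

instance [IsMarkovKernel κ] (n : ℕ) : IsMarkovKernel (pastKernel κ n) := by
  unfold pastKernel; infer_instance

variable [IsMarkovKernel κ]

/-- The law on sequence space of the chain with kernel `κ` and initial law `μ`. -/
noncomputable def chainLaw (μ : Measure S) : Measure (ℕ → S) :=
  Kernel.trajMeasure (X := fun _ => S) μ (pastKernel κ)

/-- The law on sequence space of the chain with kernel `κ`, as a function of the initial state. -/
noncomputable def chainKernel : Kernel S (ℕ → S) :=
  (Kernel.traj (X := fun _ => S) (pastKernel κ) 0).comap
    (MeasurableEquiv.piUnique (fun _ : Finset.Iic 0 => S)).symm (MeasurableEquiv.measurable _)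

instance : IsMarkovKernel (chainKernel κ) := by
  unfold chainKernel; infer_instance

/-- Reduces statements about path laws to deterministic starting points, integrated against `μ`. -/
lemma chainLaw_eq_bind (μ : Measure S) : chainLaw κ μ = μ.bind (chainKernel κ) := by
  rw [chainLaw, Kernel.trajMeasure, chainKernel]
  ext s hs
  rw [Measure.bind_apply hs (Kernel.aemeasurable _), Measure.bind_apply hs (Kernel.aemeasurable _),
    lintegral_map (Kernel.measurable_coe _ hs) (MeasurableEquiv.measurable _)]
  rfl

lemma chainLaw_dirac (x : S) : chainLaw κ (Measure.dirac x) = chainKernel κ x := by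
  rw [chainLaw_eq_bind, Measure.dirac_bind (Kernel.measurable _)]

instance (μ : Measure S) [IsProbabilityMeasure μ] : IsProbabilityMeasure (chainLaw κ μ) := by
  rw [chainLaw_eq_bind]; infer_instance

lemma chainKernel_map_zero (x : S) :
    (chainKernel κ x).map (fun ω => ω 0) = Measure.dirac x := by
  have h := Kernel.traj_map_frestrictLe_apply (X := fun _ => S) (κ := pastKernel κ) 0 0
    ((MeasurableEquiv.piUnique (fun _ : Finset.Iic 0 => S)).symm x)
  rw [Kernel.partialTraj_self, Kernel.id_apply] at h
  have hf : (fun ω : ℕ → S => ω 0) =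
      (fun y : (Finset.Iic 0 → S) => y ⟨0, by simp⟩) ∘ Preorder.frestrictLe 0 := rfl
  have hm : Measurable fun y : (Finset.Iic 0 → S) => y ⟨0, by simp⟩ := measurable_pi_apply _
  rw [chainKernel, Kernel.comap_apply, hf, ← Measure.map_map hm
    (Preorder.measurable_frestrictLe 0), h, Measure.map_dirac' hm]
  rfl

/-- The history up to time `n` and the next state have as joint law the history law composed with
`pastKernel`, which looks only at the last state; so the last factor can be integrated out. -/
lemma lintegral_chainKernel_prod_succ (x : S) (n : ℕ) (f : ℕ → S → ℝ≥0∞)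
    (hf : ∀ i, Measurable (f i)) :
    ∫⁻ ω, ∏ i ∈ Finset.range (n + 2), f i (ω i) ∂(chainKernel κ x) =
      ∫⁻ ω, (∏ i ∈ Finset.range (n + 1), f i (ω i)) * ∫⁻ y, f (n + 1) y ∂(κ (ω n))
        ∂(chainKernel κ x) := by
  have h := Kernel.map_frestrictLe_trajMeasure_compProd_eq_map_trajMeasure (X := fun _ => S)
    (μ₀ := Measure.dirac x) (κ := pastKernel κ) (a := n)
  change (chainLaw κ _).map _ ⊗ₘ _ = (chainLaw κ _).map _ at h
  rw [chainLaw_dirac] at h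
  let F : (Finset.Iic n → S) → ℝ≥0∞ := fun y => ∏ i : Finset.Iic n, f i (y i)
  have hF : Measurable F := Finset.measurable_prod _ fun i _ => (hf i).comp (measurable_pi_apply i)
  have hFω : ∀ ω : ℕ → S,
      F (Preorder.frestrictLe n ω) = ∏ i ∈ Finset.range (n + 1), f i (ω i) := fun ω => by
    have hr : Finset.range (n + 1) = Finset.Iic n := by ext; simp
    rw [hr]
    exact Finset.prod_coe_sort (Finset.Iic n) fun i => f i (ω i)
  have hG : Measurable fun z : (Finset.Iic n → S) × S => F z.1 * f (n + 1) z.2 :=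
    (hF.comp measurable_fst).mul ((hf _).comp measurable_snd)
  have h2 := congrArg (fun m => ∫⁻ z, F z.1 * f (n + 1) z.2 ∂m) h
  rw [Measure.lintegral_compProd hG, lintegral_map hG
    ((Preorder.measurable_frestrictLe n).prodMk (measurable_pi_apply _)),
    lintegral_map (by exact hG.lintegral_kernel_prod_right')
      (Preorder.measurable_frestrictLe n)] at h2
  simp only [Finset.prod_range_succ _ (n + 1)]
  simp only [← hFω]
  rw [← h2]
  refine lintegral_congr fun ω => ?_
  exact (lintegral_const_mul _ (hf (n + 1)) :
    ∫⁻ y, F (Preorder.frestrictLe n ω) * f (n + 1) y ∂(κ (ω n)) = _)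

/-- The integral of `f 0 (ω 0) * ⋯ * f (n - 1) (ω (n - 1))` along the chain. -/
noncomputable def iterProd : ℕ → (ℕ → S → ℝ≥0∞) → S → ℝ≥0∞
  | 0, _, _ => 1
  | n + 1, f, x => f 0 x * ∫⁻ y, iterProd n (fun i => f (i + 1)) y ∂(κ x)

/-- `iterProd` peels off the first factor, the trajectory measure the last. Absorbing the last
integral into the weight at time `n` reconciles the two recursions. -/
lemma iterProd_succ_succ (n : ℕ) (f : ℕ → S → ℝ≥0∞) (x : S) :
    iterProd κ (n + 2) f x =
      iterProd κ (n + 1) (Function.update f n fun y => f n y * ∫⁻ z, f (n + 1) z ∂(κ y)) x := by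
  induction n generalizing f x with
  | zero => simp [iterProd]
  | succ n ih =>
    rw [iterProd, iterProd]
    congr 1
    refine lintegral_congr fun y => ?_
    rw [ih]
    congr 1
    ext i
    by_cases hi : i = n
    · subst hi; simp
    · simp [hi]

lemma lintegral_chainKernel_prod (x : S) (n : ℕ) (f : ℕ → S → ℝ≥0∞)
    (hf : ∀ i, Measurable (f i)) :
    ∫⁻ ω, ∏ i ∈ Finset.range n, f i (ω i) ∂(chainKernel κ x) = iterProd κ n f x := by
  induction n generalizing f with
  | zero => simp [iterProd]
  | succ n ih =>
    cases n with
    | zero =>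
      have : ∫⁻ ω, f 0 (ω 0) ∂(chainKernel κ x) = f 0 x := by
        rw [← lintegral_map (μ := chainKernel κ x) (f := f 0) (g := fun ω => ω 0) (hf 0)
          (measurable_pi_apply 0), chainKernel_map_zero, lintegral_dirac' _ (hf 0)]
      simp [iterProd, this]
    | succ n =>
      rw [lintegral_chainKernel_prod_succ κ x n f hf, iterProd_succ_succ, ← ih]
      · refine lintegral_congr fun ω => ?_
        rw [Finset.prod_range_succ, Finset.prod_range_succ, mul_assoc]
        congr 1
        · refine Finset.prod_congr rfl fun i hi => ?_
          rw [Function.update_of_ne (Finset.mem_range.mp hi).ne]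
        · simp
      · intro i
        by_cases hi : i = n
        · subst hi
          simpa using! (hf i).mul (hf (i + 1)).lintegral_kernel
        · simpa [hi] using hf i

/-- The Markov property at time one. Boxes determine the measure, and on boxes it is the recursion
that defines `iterProd`. -/
lemma chainKernel_eq_map_prepend (x : S) :
    chainKernel κ x = ((κ x).bind (chainKernel κ)).map (prepend x) := by
  refine Measure.ext_of_boxes fun n B hB => ?_
  have hmeas : ∀ i, Measurable ((B i).indicator fun _ => (1 : ℝ≥0∞)) :=
    fun i => measurable_const.indicator (hB i)
  have hprod : ∀ m (f : ℕ → S → ℝ≥0∞), (∀ i, Measurable (f i)) →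
      Measurable fun ω : ℕ → S => ∏ i ∈ Finset.range m, f i (ω i) := fun m f hf =>
    Finset.measurable_prod _ fun i _ => (hf i).comp (measurable_pi_apply i)
  rw [measure_box _ n B hB, measure_box _ n B hB, lintegral_chainKernel_prod κ x n _ hmeas,
    lintegral_map (hprod _ _ hmeas) (measurable_prepend_left x)]
  cases n with
  | zero => simp [iterProd]
  | succ n =>
    simp only [iterProd, Finset.prod_range_succ', prepend]
    rw [lintegral_mul_const _ (hprod n (fun i => (B (i + 1)).indicator fun _ => 1)
        fun i => hmeas (i + 1)), mul_comm,
      Measure.lintegral_bind (Kernel.aemeasurable _)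
        (hprod n (fun i => (B (i + 1)).indicator fun _ => 1) fun i => hmeas (i + 1)).aemeasurable]
    congr 1
    refine lintegral_congr fun y => ?_
    rw [lintegral_chainKernel_prod κ y n (fun i => (B (i + 1)).indicator fun _ => 1)
      fun i => hmeas (i + 1)]

lemma lintegral_chainKernel (x : S) {G : (ℕ → S) → ℝ≥0∞} (hG : Measurable G) :
    ∫⁻ ω, G ω ∂(chainKernel κ x) =
      ∫⁻ y, ∫⁻ ω, G (prepend x ω) ∂(chainKernel κ y) ∂(κ x) := by
  conv_lhs => rw [chainKernel_eq_map_prepend]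
  rw [lintegral_map hG (measurable_prepend_left x),
    Measure.lintegral_bind (Kernel.aemeasurable _) (f := fun ω => G (prepend x ω))
      (hG.comp (measurable_prepend_left x)).aemeasurable]

/-- The shift on sequences. -/
def seqShift (ω : ℕ → S) : ℕ → S := fun t => ω (t + 1)

lemma measurable_seqShift : Measurable (seqShift (S := S)) :=
  measurable_pi_lambda _ fun n => measurable_pi_apply (n + 1)

lemma chainLaw_map_seqShift (μ : Measure S) :
    (chainLaw κ μ).map seqShift = chainLaw κ (μ.bind κ) := by
  ext s hs
  have hs' : MeasurableSet (seqShift ⁻¹' s) := measurable_seqShift hs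
  rw [Measure.map_apply measurable_seqShift hs, chainLaw_eq_bind, chainLaw_eq_bind,
    Measure.bind_apply hs (Kernel.aemeasurable _), Measure.bind_apply hs' (Kernel.aemeasurable _),
    Measure.lintegral_bind (Kernel.aemeasurable _) (Kernel.measurable_coe _ hs).aemeasurable]
  refine lintegral_congr fun x => ?_
  rw [← lintegral_indicator_one hs', lintegral_chainKernel κ x (measurable_one.indicator hs')]
  refine lintegral_congr fun y => ?_
  rw [← lintegral_indicator_one hs]
  rfl

lemma chainLaw_map_zero (μ : Measure S) : (chainLaw κ μ).map (fun ω => ω 0) = μ := by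
  ext s hs
  rw [Measure.map_apply (measurable_pi_apply 0) hs, chainLaw_eq_bind,
    Measure.bind_apply (measurable_pi_apply 0 hs) (Kernel.aemeasurable _)]
  have : ∀ x, chainKernel κ x ((fun ω => ω 0) ⁻¹' s) = s.indicator 1 x := fun x => by
    rw [← Measure.map_apply (measurable_pi_apply 0) hs, chainKernel_map_zero,
      Measure.dirac_apply' _ hs]
  simp_rw [this]
  exact lintegral_indicator_one hs

/-! ### Ergodicity of the shift and extremality of invariant measures. -/

variable {κ}

lemma measurePreserving_seqShift {μ : Measure S} (hμ : Kernel.Invariant κ μ) :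
    MeasurePreserving seqShift (chainLaw κ μ) (chainLaw κ μ) :=
  ⟨measurable_seqShift, by rw [chainLaw_map_seqShift, hμ.def]⟩

/-- If the path law of `μ` is ergodic, then an invariant measure that is absolutely continuous
with respect to `μ` is a multiple of `μ`. -/
lemma eq_smul_of_ergodic {μ ν : Measure S} [IsProbabilityMeasure μ] [IsFiniteMeasure ν]
    (hμ : Ergodic seqShift (chainLaw κ μ)) (hν : Kernel.Invariant κ ν) (hνμ : ν ≪ μ) :
    ∃ c : ℝ≥0∞, ν = c • μ := by
  have hac : chainLaw κ ν ≪ chainLaw κ μ := by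
    rw [chainLaw_eq_bind, chainLaw_eq_bind]
    exact hνμ.comp_right _
  have hfin : IsFiniteMeasure (chainLaw κ ν) := by
    rw [chainLaw_eq_bind]; infer_instance
  obtain ⟨c, hc⟩ := hμ.eq_smul_of_absolutelyContinuous (measurePreserving_seqShift hν) hac
  refine ⟨c, ?_⟩
  rw [← chainLaw_map_zero κ ν, hc, Measure.map_smul, chainLaw_map_zero]

lemma chainKernel_apply (x : S) {s : Set (ℕ → S)} (hs : MeasurableSet s) :
    chainKernel κ x s = ∫⁻ y, chainKernel κ y (prepend x ⁻¹' s) ∂(κ x) := by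
  rw [← lintegral_indicator_one hs, lintegral_chainKernel κ x (measurable_one.indicator hs)]
  refine lintegral_congr fun y => ?_
  rw [← lintegral_indicator_one (measurable_prepend_left x hs)]
  rfl

/-- A bounded harmonic function is constant along the stationary chain. -/
lemma ae_eq_of_harmonic {μ : Measure S} [IsProbabilityMeasure μ] (hμ : Kernel.Invariant κ μ)
    {f : S → ℝ} (hf : Measurable f) {C : ℝ} (hC : ∀ x, |f x| ≤ C)
    (hharm : ∀ x, f x = ∫ y, f y ∂(κ x)) : ∀ᵐ z ∂(μ ⊗ₘ κ), f z.2 = f z.1 := by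
  have hf1 : Measurable fun z : S × S => f z.1 := hf.comp measurable_fst
  have hf2 : Measurable fun z : S × S => f z.2 := hf.comp measurable_snd
  have hb : ∀ x y, |f x * f y| ≤ C * C := fun x y => by
    rw [abs_mul]
    exact mul_le_mul (hC x) (hC y) (abs_nonneg _) ((abs_nonneg _).trans (hC x))
  have i11 : Integrable (fun z : S × S => f z.1 * f z.1) (μ ⊗ₘ κ) :=
    .of_bound (hf1.mul hf1).aestronglyMeasurable (C * C) (.of_forall fun z => hb _ _)
  have i12 : Integrable (fun z : S × S => f z.1 * f z.2) (μ ⊗ₘ κ) :=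
    .of_bound (hf1.mul hf2).aestronglyMeasurable (C * C) (.of_forall fun z => hb _ _)
  have i22 : Integrable (fun z : S × S => f z.2 * f z.2) (μ ⊗ₘ κ) :=
    .of_bound (hf2.mul hf2).aestronglyMeasurable (C * C) (.of_forall fun z => hb _ _)
  have e11 : ∫ z, f z.1 * f z.1 ∂(μ ⊗ₘ κ) = ∫ x, f x * f x ∂μ := by
    rw [Measure.integral_compProd i11]
    simp
  have e12 : ∫ z, f z.1 * f z.2 ∂(μ ⊗ₘ κ) = ∫ x, f x * f x ∂μ := by
    rw [Measure.integral_compProd i12]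
    refine integral_congr_ae (.of_forall fun x => ?_)
    simp only
    rw [integral_const_mul, ← hharm x]
  have e22 : ∫ z, f z.2 * f z.2 ∂(μ ⊗ₘ κ) = ∫ x, f x * f x ∂μ := by
    have h : (μ ⊗ₘ κ).map Prod.snd = μ := by
      have := Measure.snd_compProd μ κ
      rwa [hμ.def] at this
    conv_rhs => rw [← h]
    exact (integral_map (f := fun y => f y * f y) measurable_snd.aemeasurable
      (hf.mul hf).aestronglyMeasurable).symm
  -- By harmonicity and invariance all three terms of the expanded square integrate to `∫ f²`.
  have hzero : ∫ z, (f z.2 - f z.1) ^ 2 ∂(μ ⊗ₘ κ) = 0 := by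
    have : ∀ z : S × S, (f z.2 - f z.1) ^ 2 =
        f z.2 * f z.2 - 2 * (f z.1 * f z.2) + f z.1 * f z.1 := fun z => by ring
    simp_rw [this]
    rw [integral_add (by exact i22.sub (i12.const_mul 2)) i11, integral_sub i22 (i12.const_mul 2),
      integral_const_mul, e11, e12, e22]
    ring
  have hint : Integrable (fun z : S × S => (f z.2 - f z.1) ^ 2) (μ ⊗ₘ κ) := by
    have : (fun z : S × S => (f z.2 - f z.1) ^ 2) = fun z =>
        f z.2 * f z.2 - 2 * (f z.1 * f z.2) + f z.1 * f z.1 := by ext z; ring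
    rw [this]
    exact (i22.sub (i12.const_mul 2)).add i11
  rw [integral_eq_zero_iff_of_nonneg (fun z => sq_nonneg _) hint] at hzero
  filter_upwards [hzero] with z hz
  exact sub_eq_zero.mp (pow_eq_zero_iff two_ne_zero |>.mp hz)

/-- An invariant probability measure that dominates only its own multiples among the invariant
measures has an ergodic path law. -/
lemma ergodic_of_extremal {μ : Measure S} [IsProbabilityMeasure μ] (hμ : Kernel.Invariant κ μ)
    (hext : ∀ ν ≤ μ, Kernel.Invariant κ ν → ∃ c : ℝ≥0∞, ν = c • μ) :
    Ergodic seqShift (chainLaw κ μ) := by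
  refine ⟨measurePreserving_seqShift hμ, ⟨fun s hs hinv => ?_⟩⟩
  set φ : S → ℝ≥0∞ := fun x => chainKernel κ x s with hφ
  have hφm : Measurable φ := Kernel.measurable_coe _ hs
  have hφ1 : ∀ x, φ x ≤ 1 := fun x => prob_le_one
  have hφt : ∀ x, φ x ≠ ∞ := fun x => (hφ1 x).trans_lt ENNReal.one_lt_top |>.ne
  have hpre : ∀ x, prepend x ⁻¹' s = s := fun x => by
    conv_lhs => rw [← hinv]
    rfl
  have hharm : ∀ x, φ x = ∫⁻ y, φ y ∂(κ x) := fun x => by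
    simp only [hφ]
    rw [chainKernel_apply x hs, hpre]
  have hae : ∀ᵐ z ∂(μ ⊗ₘ κ), φ z.2 = φ z.1 := by
    have := ae_eq_of_harmonic hμ hφm.ennreal_toReal (C := 1)
      (fun x => by
        rw [abs_of_nonneg ENNReal.toReal_nonneg]
        exact ENNReal.toReal_le_of_le_ofReal zero_le_one (by simpa using hφ1 x))
      (fun x => by
        rw [integral_toReal hφm.aemeasurable (.of_forall fun y => (hφt y).lt_top), ← hharm])
    filter_upwards [this] with z hz
    exact (ENNReal.toReal_eq_toReal_iff' (hφt _) (hφt _)).mp hz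
  have hsnd : (μ ⊗ₘ κ).map Prod.snd = μ := by
    have := Measure.snd_compProd μ κ
    rwa [hμ.def] at this
  -- Since `φ` does not change along a step of the stationary chain, it may be evaluated after the
  -- step instead of before; hence `φ μ` is invariant, and extremality makes `φ` constant.
  have hνinv : Kernel.Invariant κ (μ.withDensity φ) := by
    rw [Kernel.Invariant]
    ext B hB
    have hind : Measurable fun z : S × S => φ z.1 * B.indicator 1 z.2 :=
      (hφm.comp measurable_fst).mul ((measurable_one.indicator hB).comp measurable_snd)
    rw [Measure.bind_apply hB (Kernel.aemeasurable _),
      lintegral_withDensity_eq_lintegral_mul _ hφm (Kernel.measurable_coe _ hB),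
      withDensity_apply _ hB]
    calc ∫⁻ x, (φ * fun x => κ x B) x ∂μ
        = ∫⁻ z, φ z.1 * B.indicator 1 z.2 ∂(μ ⊗ₘ κ) := by
          rw [Measure.lintegral_compProd hind]
          refine lintegral_congr fun x => ?_
          simp only [Pi.mul_apply]
          rw [lintegral_const_mul _ (measurable_one.indicator hB), lintegral_indicator_one hB]
      _ = ∫⁻ z, φ z.2 * B.indicator 1 z.2 ∂(μ ⊗ₘ κ) := by
          refine lintegral_congr_ae ?_
          filter_upwards [hae] with z hz
          rw [hz]
      _ = ∫⁻ y, φ y * B.indicator 1 y ∂μ := by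
          conv_rhs => rw [← hsnd]
          exact (lintegral_map (f := fun y => φ y * B.indicator 1 y)
            (hφm.mul (measurable_one.indicator hB)) measurable_snd).symm
      _ = ∫⁻ y in B, φ y ∂μ := by
          rw [← lintegral_indicator hB]
          refine lintegral_congr fun y => ?_
          by_cases hy : y ∈ B <;> simp [hy]
  have hle : μ.withDensity φ ≤ μ := by
    calc μ.withDensity φ ≤ μ.withDensity 1 := withDensity_mono (.of_forall hφ1)
      _ = μ := withDensity_one
  obtain ⟨c, hc⟩ := hext _ hle hνinv
  have hφc : φ =ᵐ[μ] fun _ => c := by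
    rw [← withDensity_const] at hc
    exact (withDensity_eq_iff_of_sigmaFinite hφm.aemeasurable aemeasurable_const).mp hc
  -- The event `s` is independent of every finite box, hence of itself, which leaves only the
  -- probabilities `0` and `1`.
  have hbox : ∀ (n : ℕ) (B : ℕ → Set S), (∀ i, MeasurableSet (B i)) → ∀ᵐ x ∂μ,
      chainKernel κ x (s ∩ {ω | ∀ i < n, ω i ∈ B i}) =
        c * chainKernel κ x {ω | ∀ i < n, ω i ∈ B i} := by
    intro n
    induction n with
    | zero =>
      intro B _
      filter_upwards [hφc] with x hx
      simpa using hx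
    | succ n ih =>
      intro B hB
      have h1 := ih (fun i => B (i + 1)) fun i => hB (i + 1)
      -- Writing `μ` as `μ.bind κ` turns the induction hypothesis into a statement about almost
      -- every successor of almost every `x`.
      nth_rw 1 [← hμ.def] at h1
      have hmB := measurableSet_box (n + 1) B hB
      filter_upwards [Measure.ae_ae_of_ae_comp h1] with x hx
      rw [chainKernel_apply x (hs.inter hmB), chainKernel_apply x hmB,
        ← lintegral_const_mul' _ _ (by
          rintro rfl
          have h2 : μ.withDensity φ univ ≤ μ univ := hle univ
          rw [hc] at h2
          simp at h2)]
      refine lintegral_congr_ae ?_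
      filter_upwards [hx] with y hy
      rw [preimage_inter, hpre]
      have hpB : prepend x ⁻¹' {ω | ∀ i < n + 1, ω i ∈ B i} =
          {ω | x ∈ B 0 ∧ ∀ i < n, ω i ∈ B (i + 1)} := by
        ext ω
        simp only [mem_preimage, mem_ofPred_eq]
        constructor
        · intro h
          exact ⟨h 0 n.succ_pos, fun i hi => h (i + 1) (Nat.succ_lt_succ hi)⟩
        · rintro ⟨h0, h⟩ i hi
          cases i with
          | zero => exact h0
          | succ i => exact h i (Nat.lt_of_succ_lt_succ hi)
      rw [hpB]
      by_cases hx0 : x ∈ B 0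
      · simpa [hx0] using hy
      · simp [hx0]
  have hmeas : (chainLaw κ μ).restrict s = c • chainLaw κ μ := by
    refine Measure.ext_of_boxes fun n B hB => ?_
    have hmB := measurableSet_box n B hB
    rw [Measure.restrict_apply hmB, Measure.smul_apply, chainLaw_eq_bind, smul_eq_mul,
      Measure.bind_apply (hmB.inter hs) (Kernel.aemeasurable _),
      Measure.bind_apply hmB (Kernel.aemeasurable _),
      ← lintegral_const_mul _ (Kernel.measurable_coe _ hmB)]
    refine lintegral_congr_ae ?_
    filter_upwards [hbox n B hB] with x hx
    rw [inter_comm, hx]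
  have h1 : chainLaw κ μ s = c := by
    simpa using congrArg (fun m => m univ) hmeas
  have h2 : chainLaw κ μ s = c * chainLaw κ μ s := by
    simpa using congrArg (fun m => m s) hmeas
  rw [Filter.eventuallyConst_set']
  rw [h1] at h2
  by_cases hc0 : c = 0
  · left
    rw [ae_eq_empty, h1, hc0]
  · right
    rw [ae_eq_univ, prob_compl_eq_zero_iff hs, h1]
    have hct : c ≠ ∞ := h1 ▸ measure_ne_top _ _
    exact ((ENNReal.mul_eq_left hc0 hct).mp h2.symm)

end MarkovChain

/-! ### The lattice of invariant measures. -/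

section InvariantMeasures

variable {S : Type*} [MeasurableSpace S] {κ : Kernel S S}

lemma bind_mono {μ ν : Measure S} (h : μ ≤ ν) : μ.bind κ ≤ ν.bind κ := by
  refine Measure.le_iff.mpr fun s hs => ?_
  rw [Measure.bind_apply hs (Kernel.aemeasurable _), Measure.bind_apply hs (Kernel.aemeasurable _)]
  exact lintegral_mono' h le_rfl

lemma ProbabilityTheory.Kernel.Invariant.smul {μ : Measure S} (hμ : Kernel.Invariant κ μ) (c : ℝ≥0∞) :
    Kernel.Invariant κ (c • μ) := by
  ext s hs
  have h := congrArg (fun m => m s) hμ.def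
  simp only [Measure.bind_apply hs (Kernel.aemeasurable _)] at h
  rw [Measure.bind_apply hs (Kernel.aemeasurable _), lintegral_smul_measure, h]
  rfl

lemma ProbabilityTheory.Kernel.Invariant.sub {μ ν : Measure S} [IsFiniteMeasure ν]
    (hμ : Kernel.Invariant κ μ) (hν : Kernel.Invariant κ ν) (h : ν ≤ μ) :
    Kernel.Invariant κ (μ - ν) := by
  ext s hs
  have h1 := congrArg (fun m => m s) hμ.def
  have h2 := congrArg (fun m => m s) hν.def
  simp only [Measure.bind_apply hs (Kernel.aemeasurable _)] at h1 h2
  have h3 : ∫⁻ x, κ x s ∂μ = ∫⁻ x, κ x s ∂(μ - ν) + ∫⁻ x, κ x s ∂ν := by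
    rw [← lintegral_add_measure, Measure.sub_add_cancel_of_le h]
  have h4 : μ s = (μ - ν) s + ν s := by
    rw [← Measure.add_apply, Measure.sub_add_cancel_of_le h]
  rw [h1, h2, h4] at h3
  rw [Measure.bind_apply hs (Kernel.aemeasurable _)]
  exact ((ENNReal.add_left_inj (measure_ne_top ν s)).mp h3).symm

lemma bind_le_smul {m μ : Measure S} [IsProbabilityMeasure μ] {C : ℝ≥0∞} (hμ : μ ≪ m)
    (h : ∀ᵐ x ∂m, κ x ≤ C • m) : μ.bind κ ≤ C • m := by
  refine Measure.le_iff.mpr fun s hs => ?_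
  rw [Measure.bind_apply hs (Kernel.aemeasurable _)]
  calc ∫⁻ x, κ x s ∂μ ≤ ∫⁻ _, (C • m) s ∂μ := by
        refine lintegral_mono_ae ?_
        filter_upwards [hμ.ae_le h] with x hx using hx s
    _ = (C • m) s := by simp

variable [IsMarkovKernel κ]

/-- A Markov kernel preserves total mass, so an inequality between the two finite measures is an
equality. -/
lemma ProbabilityTheory.Kernel.Invariant.of_le {μ : Measure S} [IsFiniteMeasure μ] (h : μ.bind κ ≤ μ) :
    Kernel.Invariant κ μ := by
  refine Measure.eq_of_le_of_measure_univ_eq h ?_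
  rw [Measure.bind_apply .univ (Kernel.aemeasurable _)]
  simp

lemma ProbabilityTheory.Kernel.Invariant.inf {μ ν : Measure S} [IsFiniteMeasure μ]
    (hμ : Kernel.Invariant κ μ) (hν : Kernel.Invariant κ ν) : Kernel.Invariant κ (μ ⊓ ν) := by
  have : IsFiniteMeasure (μ ⊓ ν) := isFiniteMeasure_of_le μ inf_le_left
  refine Kernel.Invariant.of_le (le_inf ?_ ?_)
  · exact (bind_mono inf_le_left).trans hμ.def.le
  · exact (bind_mono inf_le_right).trans hν.def.le

/-- If an invariant probability measure dominates an invariant measure that is not one of its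
multiples, then it dominates two nonzero invariant measures that are mutually singular. -/
lemma exists_mutuallySingular_invariant {μ ν : Measure S} [IsProbabilityMeasure μ]
    (hμ : Kernel.Invariant κ μ) (hν : Kernel.Invariant κ ν) (hle : ν ≤ μ)
    (hne : ∀ c : ℝ≥0∞, ν ≠ c • μ) :
    ∃ ν₁ ν₂ : Measure S, Kernel.Invariant κ ν₁ ∧ Kernel.Invariant κ ν₂ ∧ ν₁ ≠ 0 ∧ ν₂ ≠ 0 ∧
      ν₁ ≪ μ ∧ ν₂ ≪ μ ∧ IsFiniteMeasure ν₁ ∧ IsFiniteMeasure ν₂ ∧ ν₁ ⟂ₘ ν₂ := by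
  have hfν : IsFiniteMeasure ν := isFiniteMeasure_of_le μ hle
  -- With this `t`, the measures `ν` and `t • μ` have the same mass and differ, so neither dominates
  -- the other. Removing their infimum leaves two nonzero singular parts.
  set t := ν univ with ht
  have htt : t ≠ ∞ := measure_ne_top _ _
  have hft : IsFiniteMeasure (t • μ) := Measure.smul_finite μ htt
  have htm : (t • μ) univ = ν univ := by simp [ht]
  set ρ := ν ⊓ t • μ with hρ
  have hρ1 : ρ ≤ ν := inf_le_left
  have hρ2 : ρ ≤ t • μ := inf_le_right
  have hfρ : IsFiniteMeasure ρ := isFiniteMeasure_of_le ν hρ1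
  have hρi : Kernel.Invariant κ ρ := hν.inf (hμ.smul t)
  have e1 := Measure.sub_add_cancel_of_le hρ1
  have e2 := Measure.sub_add_cancel_of_le hρ2
  refine ⟨ν - ρ, t • μ - ρ, hν.sub hρi hρ1, (hμ.smul t).sub hρi hρ2, ?_, ?_, ?_, ?_,
    inferInstance, inferInstance, ?_⟩
  · intro h0
    rw [h0, zero_add] at e1
    exact hne t (Measure.eq_of_le_of_measure_univ_eq (e1 ▸ hρ2) htm.symm)
  · intro h0
    rw [h0, zero_add] at e2
    exact hne t (Measure.eq_of_le_of_measure_univ_eq (e2 ▸ hρ1) htm).symm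
  · exact (Measure.absolutelyContinuous_of_le (Measure.sub_le.trans hle))
  · exact (Measure.absolutelyContinuous_of_le Measure.sub_le).trans
      Measure.smul_absolutelyContinuous
  · rw [Measure.mutuallySingular_iff_disjoint, disjoint_iff_inf_le]
    set σ := (ν - ρ) ⊓ (t • μ - ρ)
    have h1 : σ + ρ ≤ ρ := by
      refine le_inf ?_ ?_
      · calc σ + ρ ≤ (ν - ρ) + ρ := by gcongr; exact inf_le_left
          _ = ν := e1
      · calc σ + ρ ≤ (t • μ - ρ) + ρ := by gcongr; exact inf_le_right
          _ = t • μ := e2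
    refine Measure.le_iff.mpr fun s _ => ?_
    have h2 := h1 s
    rw [Measure.add_apply] at h2
    have : σ s = 0 := by
      by_contra h0
      exact absurd h2 (not_le.mpr (by
        rw [add_comm]
        exact ENNReal.lt_add_right (measure_ne_top ρ s) h0))
    simp [this]

/-! ### Existence of invariant and of extremal measures under domination. -/

/-- A limit along an ultrafilter of probability measures that are uniformly dominated by a finite
measure is, on all measurable sets, given by a probability measure. -/
lemma exists_ultrafilter_limit {m : Measure S} [IsFiniteMeasure m] {C : ℝ≥0∞} (hC : C ≠ ∞)
    (U : Ultrafilter ℕ) (ν : ℕ → Measure S) [∀ n, IsProbabilityMeasure (ν n)]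
    (hν : ∀ n, ν n ≤ C • m) :
    ∃ μ : Measure S, IsProbabilityMeasure μ ∧ μ ≤ C • m ∧
      ∀ s, MeasurableSet s → Filter.Tendsto (fun n => ν n s) U (nhds (μ s)) := by
  have hlim : ∀ s, ∃ L, Filter.Tendsto (fun n => ν n s) U (nhds L) := fun s =>
    ⟨_, (U.map fun n => ν n s).le_nhds_lim⟩
  choose Φ hΦ using hlim
  have hΦle : ∀ s, Φ s ≤ C * m s := fun s =>
    le_of_tendsto (hΦ s) (.of_forall fun n => by simpa using hν n s)
  have hΦunion : ∀ s t, MeasurableSet t → Disjoint s t → Φ (s ∪ t) = Φ s + Φ t := fun s t ht hd =>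
    tendsto_nhds_unique (hΦ (s ∪ t)) (((hΦ s).add (hΦ t)).congr fun n =>
      (measure_union hd ht).symm)
  have hΦ0 : Φ ∅ = 0 := tendsto_nhds_unique (hΦ ∅) (by simp)
  have hΦsum : ∀ ⦃f : ℕ → Set S⦄, (∀ i, MeasurableSet (f i)) → Pairwise (Function.onFun Disjoint f) →
      Φ (⋃ i, f i) = ∑' i, Φ (f i) := by
    intro f hf hd
    have htail : ∀ n, Φ (⋃ i, f i) = ∑ i ∈ Finset.range n, Φ (f i) + Φ (⋃ i, f (i + n)) := by
      intro n
      induction n with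
      | zero => simp
      | succ n ih =>
        have hsplit : (⋃ i, f (i + n)) = f n ∪ ⋃ i, f (i + (n + 1)) := by
          ext x
          simp only [mem_iUnion, mem_union]
          constructor
          · rintro ⟨i, hi⟩
            cases i with
            | zero => left; simpa using hi
            | succ i => right; exact ⟨i, by rwa [show i + (n + 1) = i + 1 + n by ring]⟩
          · rintro (h | ⟨i, hi⟩)
            · exact ⟨0, by simpa using h⟩
            · exact ⟨i + 1, by rwa [show i + 1 + n = i + (n + 1) by ring]⟩
        rw [ih, hsplit, hΦunion _ _ (MeasurableSet.iUnion fun i => hf _), Finset.sum_range_succ,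
          add_assoc]
        rw [disjoint_iUnion_right]
        exact fun i => hd (by omega)
    -- Setwise limits are only finitely additive in general; domination by `C • m` makes the tails
    -- vanish and gives countable additivity.
    have hm0 : Filter.Tendsto (fun n => C * m (⋃ i, f (i + n))) Filter.atTop (nhds 0) := by
      have h1 : ∑' i, m (f i) ≠ ∞ := by
        rw [← measure_iUnion hd hf]; exact measure_ne_top _ _
      have h2 := ENNReal.tendsto_sum_nat_add (fun i => m (f i)) h1
      have h3 := ENNReal.Tendsto.const_mul h2 (Or.inr hC)
      rw [mul_zero] at h3
      refine h3.congr fun n => ?_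
      rw [measure_iUnion (f := fun i => f (i + n)) (fun i j hij => hd (by omega)) fun i => hf _]
    have ht0 : Filter.Tendsto (fun n => Φ (⋃ i, f (i + n))) Filter.atTop (nhds 0) :=
      tendsto_of_tendsto_of_tendsto_of_le_of_le tendsto_const_nhds hm0 (fun _ => zero_le)
        fun n => hΦle _
    have hs := (ENNReal.summable (f := fun i => Φ (f i))).hasSum.tendsto_sum_nat
    have h5 := hs.add ht0
    rw [add_zero] at h5
    exact tendsto_nhds_unique (tendsto_const_nhds.congr htail) h5
  let μ : Measure S := Measure.ofMeasurable (fun s _ => Φ s) hΦ0 fun f hf hd => hΦsum hf hd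
  have hμ : ∀ s, MeasurableSet s → μ s = Φ s := fun s hs => Measure.ofMeasurable_apply s hs
  refine ⟨μ, ⟨?_⟩, Measure.le_iff.mpr fun s hs => ?_, fun s hs => ?_⟩
  · rw [hμ univ .univ]
    exact tendsto_nhds_unique (hΦ univ) (by simp)
  · rw [hμ s hs]; exact hΦle s
  · rw [hμ s hs]; exact hΦ s

/-- Lower semicontinuity of the integral under setwise convergence. -/
lemma lintegral_le_of_tendsto_setwise {μ : Measure S} [IsFiniteMeasure μ] {U : Filter ℕ} [U.NeBot]
    {ν : ℕ → Measure S} (h : ∀ s, MeasurableSet s → Filter.Tendsto (fun n => ν n s) U (nhds (μ s)))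
    (f : S → ℝ≥0∞) (hf : ∀ x, f x ≤ 1) {L : ℝ≥0∞} {u : ℕ → ℝ≥0∞}
    (hu : Filter.Tendsto u U (nhds L)) (hle : ∀ n, ∫⁻ x, f x ∂(ν n) ≤ u n) :
    ∫⁻ x, f x ∂μ ≤ L := by
  rw [lintegral]
  refine iSup₂_le fun g hg => ?_
  have hg1 : ∀ c ∈ g.range, c ≠ ∞ := by
    intro c hc
    obtain ⟨x, rfl⟩ := SimpleFunc.mem_range.mp hc
    exact (((hg x).trans (hf x)).trans_lt ENNReal.one_lt_top).ne
  have h1 : Filter.Tendsto (fun n => g.lintegral (ν n)) U (nhds (g.lintegral μ)) :=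
    tendsto_finsetSum _ fun c hc =>
      ENNReal.Tendsto.const_mul (h _ (g.measurableSet_fiber c)) (Or.inr (hg1 c hc))
  refine le_of_tendsto_of_tendsto' h1 hu fun n => ?_
  calc g.lintegral (ν n) = ∫⁻ x, g x ∂(ν n) := (g.lintegral_eq_lintegral _).symm
    _ ≤ ∫⁻ x, f x ∂(ν n) := lintegral_mono hg
    _ ≤ u n := hle n

/-- A Markov kernel whose transition probabilities are almost everywhere dominated by one multiple
of a finite measure `m` has an invariant probability measure that is absolutely continuous. -/
lemma exists_invariant_of_le_smul {m : Measure S} [IsFiniteMeasure m] (hm : m ≠ 0) {C : ℝ≥0∞}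
    (hC : C ≠ ∞) (h : ∀ᵐ x ∂m, κ x ≤ C • m) :
    ∃ μ : Measure S, IsProbabilityMeasure μ ∧ μ ≪ m ∧ Kernel.Invariant κ μ := by
  have hm0 : m univ ≠ 0 := by simpa using hm
  -- The second entry is there because the starting measure, normalized `m`, must obey the bound as
  -- well.
  let D := max C (m univ)⁻¹
  have hD : D ≠ ∞ := (max_lt hC.lt_top (ENNReal.inv_lt_top.mpr (pos_iff_ne_zero.mpr hm0))).ne
  let ν : ℕ → Measure S := fun n => (fun μ => μ.bind κ)^[n] ((m univ)⁻¹ • m)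
  have hν0 : ν 0 = (m univ)⁻¹ • m := rfl
  have hνs : ∀ n, ν (n + 1) = (ν n).bind κ := fun n => Function.iterate_succ_apply' _ _ _
  have hν : ∀ n, IsProbabilityMeasure (ν n) ∧ ν n ≤ D • m := by
    intro n
    induction n with
    | zero =>
      refine ⟨⟨?_⟩, ?_⟩
      · rw [hν0, Measure.smul_apply, smul_eq_mul,
          ENNReal.inv_mul_cancel hm0 (measure_ne_top _ _)]
      · rw [hν0]
        exact Measure.le_iff.mpr fun s _ => by
          simp only [Measure.smul_apply, smul_eq_mul]
          gcongr
          exact le_max_right _ _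
    | succ n ih =>
      have := ih.1
      rw [hνs]
      refine ⟨inferInstance, (bind_le_smul ?_ h).trans ?_⟩
      · exact (Measure.absolutelyContinuous_of_le ih.2).trans Measure.smul_absolutelyContinuous
      · exact Measure.le_iff.mpr fun s _ => by
          simp only [Measure.smul_apply, smul_eq_mul]
          gcongr
          exact le_max_left _ _
  have hνp : ∀ n, IsProbabilityMeasure (ν n) := fun n => (hν n).1
  let c : ℕ → ℝ≥0∞ := fun n => ((n : ℝ≥0∞) + 1)⁻¹
  have hc : ∀ n, c n * ((n : ℝ≥0∞) + 1) = 1 := fun n =>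
    ENNReal.inv_mul_cancel (by simp) (by finiteness)
  let A : ℕ → Measure S := fun n => c n • ∑ k ∈ Finset.range (n + 1), ν k
  have hA : ∀ n s, A n s = c n * ∑ k ∈ Finset.range (n + 1), ν k s := fun n s => by
    simp [A]
  have hAp : ∀ n, IsProbabilityMeasure (A n) := fun n => ⟨by
    rw [hA]
    simpa using hc n⟩
  have hAD : ∀ n, A n ≤ D • m := fun n => Measure.le_iff.mpr fun s _ => by
    rw [hA]
    calc c n * ∑ k ∈ Finset.range (n + 1), ν k s
        ≤ c n * ∑ k ∈ Finset.range (n + 1), (D • m) s := by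
          gcongr with k
          exact (hν k).2
      _ = c n * ((n : ℝ≥0∞) + 1) * (D • m) s := by
          rw [Finset.sum_const, Finset.card_range, nsmul_eq_mul, mul_assoc]
          push_cast
          rfl
      _ = (D • m) s := by rw [hc, one_mul]
  obtain ⟨μ, hμp, hμD, hμ⟩ := exists_ultrafilter_limit hD (Filter.hyperfilter ℕ) A hAD
  refine ⟨μ, hμp, (Measure.absolutelyContinuous_of_le hμD).trans
    Measure.smul_absolutelyContinuous, Kernel.Invariant.of_le (Measure.le_iff.mpr fun s hs => ?_)⟩
  rw [Measure.bind_apply hs (Kernel.aemeasurable _)]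
  have hc0 : Filter.Tendsto c (Filter.hyperfilter ℕ) (nhds 0) := by
    have h1 : Filter.Tendsto c Filter.atTop (nhds 0) := by
      have := (Filter.tendsto_add_atTop_iff_nat 1).mpr ENNReal.tendsto_inv_nat_nhds_zero
      simpa [c] using this
    exact h1.mono_left (Filter.hyperfilter_le_cofinite.trans Nat.cofinite_eq_atTop.le)
  -- One step of the chain shifts the sum in the Cesàro average `A n`, so it raises `A n s` by at
  -- most `c n`, which tends to `0`.
  refine lintegral_le_of_tendsto_setwise hμ (fun x => κ x s) (fun x => prob_le_one)
    (u := fun n => A n s + c n) (by simpa using (hμ s hs).add hc0) fun n => ?_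
  have h1 : ∫⁻ x, κ x s ∂(A n) = c n * ∑ k ∈ Finset.range (n + 1), ν (k + 1) s := by
    simp only [A]
    rw [lintegral_smul_measure, lintegral_finsetSum_measure, smul_eq_mul]
    congr 1
    refine Finset.sum_congr rfl fun k _ => ?_
    rw [hνs, Measure.bind_apply hs (Kernel.aemeasurable _)]
  rw [h1, hA]
  calc c n * ∑ k ∈ Finset.range (n + 1), ν (k + 1) s
      ≤ c n * (∑ k ∈ Finset.range (n + 1), ν k s + 1) := by
        gcongr
        calc ∑ k ∈ Finset.range (n + 1), ν (k + 1) s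
            ≤ ∑ k ∈ Finset.range (n + 1), ν (k + 1) s + ν 0 s := le_self_add
          _ = ∑ k ∈ Finset.range (n + 1), ν k s + ν (n + 1) s := by
            rw [← Finset.sum_range_succ' (fun k => ν k s), Finset.sum_range_succ]
          _ ≤ _ := by gcongr; exact prob_le_one
    _ = _ := by rw [mul_add, mul_one]

/-- A Markov kernel whose transition probabilities are almost everywhere dominated by one multiple
of a finite measure `m` has an absolutely continuous invariant probability measure that dominates
only its own multiples among the invariant measures. -/
lemma exists_extremal_of_le_smul {m : Measure S} [IsFiniteMeasure m] (hm : m ≠ 0) {C : ℝ≥0∞}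
    (hC : C ≠ ∞) (h : ∀ᵐ x ∂m, κ x ≤ C • m) :
    ∃ μ : Measure S, IsProbabilityMeasure μ ∧ μ ≪ m ∧ Kernel.Invariant κ μ ∧
      ∀ ν ≤ μ, Kernel.Invariant κ ν → ∃ c : ℝ≥0∞, ν = c • μ := by
  let V : Set ℝ≥0∞ := {v | ∃ (μ : Measure S) (E : Set S), IsProbabilityMeasure μ ∧ μ ≪ m ∧
    Kernel.Invariant κ μ ∧ MeasurableSet E ∧ μ Eᶜ = 0 ∧ m E = v}
  have hVC : ∀ v ∈ V, C⁻¹ ≤ v := by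
    rintro v ⟨μ, E, hμ, hac, hinv, hE, hE0, rfl⟩
    have h1 : μ ≤ C • m := by
      have := bind_le_smul hac h
      rwa [hinv.def] at this
    have h2 : μ E = 1 := (prob_compl_eq_zero_iff hE).mp hE0
    have h3 : (1 : ℝ≥0∞) ≤ C * m E := by simpa [h2] using h1 E
    rw [← one_div]
    exact ENNReal.div_le_of_le_mul' h3
  obtain ⟨μ₀, hμ₀, hac₀, hinv₀⟩ := exists_invariant_of_le_smul hm hC h
  have hV₀ : m univ ∈ V := ⟨μ₀, univ, hμ₀, hac₀, hinv₀, .univ, by simp, rfl⟩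
  have hV : sInf V ≠ ∞ := ((sInf_le hV₀).trans_lt (measure_lt_top m _)).ne
  -- Every carrier has measure at least `C⁻¹`. If one this close to the infimum split into two
  -- carriers, one of measure at least `sInf V` and the other at least `C⁻¹`, it would be too large.
  have hlt : sInf V < sInf V + C⁻¹ := ENNReal.lt_add_right hV (ENNReal.inv_ne_zero.mpr hC)
  obtain ⟨v, ⟨μ, E, hμ, hac, hinv, hE, hE0, rfl⟩, hv⟩ := sInf_lt_iff.mp hlt
  refine ⟨μ, hμ, hac, hinv, fun ν hνμ hν => ?_⟩
  by_contra! hne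
  obtain ⟨ν₁, ν₂, hi₁, hi₂, hn₁, hn₂, hac₁, hac₂, hf₁, hf₂, hsing⟩ :=
    exists_mutuallySingular_invariant hinv hν hνμ hne
  have key : ∀ (σ : Measure S) (F : Set S), Kernel.Invariant κ σ → σ ≠ 0 → σ ≪ μ →
      IsFiniteMeasure σ → MeasurableSet F → σ Fᶜ = 0 → m (E ∩ F) ∈ V := by
    intro σ F hσi hσ0 hσac hσf hF hF0
    have hu : σ univ ≠ 0 := by simpa using hσ0
    refine ⟨(σ univ)⁻¹ • σ, E ∩ F, ⟨?_⟩, ?_, hσi.smul _, hE.inter hF, ?_, rfl⟩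
    · rw [Measure.smul_apply, smul_eq_mul, ENNReal.inv_mul_cancel hu (measure_ne_top _ _)]
    · exact Measure.smul_absolutelyContinuous.trans (hσac.trans hac)
    · rw [Measure.smul_apply, compl_inter, measure_union_null (hσac hE0) hF0, smul_zero]
  obtain ⟨F, hF, h1F, h2F⟩ := hsing
  have m1 := key ν₁ Fᶜ hi₁ hn₁ hac₁ hf₁ hF.compl (by rwa [compl_compl])
  have m2 := key ν₂ F hi₂ hn₂ hac₂ hf₂ hF h2F
  refine absurd hv (not_lt.mpr ?_)
  calc sInf V + C⁻¹ ≤ m (E ∩ Fᶜ) + m (E ∩ F) := add_le_add (sInf_le m1) (hVC _ m2)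
    _ = m E := by
      rw [add_comm, ← sdiff_eq]
      exact measure_inter_add_sdiff E hF

/-- Two invariant probability measures with ergodic path laws are equal or mutually singular. -/
lemma mutuallySingular_of_ergodic {μ ν : Measure S} [IsProbabilityMeasure μ]
    [IsProbabilityMeasure ν] (hμ : Kernel.Invariant κ μ) (hν : Kernel.Invariant κ ν)
    (heμ : Ergodic seqShift (chainLaw κ μ)) (heν : Ergodic seqShift (chainLaw κ ν))
    (hne : μ ≠ ν) : μ ⟂ₘ ν := by
  rw [Measure.mutuallySingular_iff_disjoint, disjoint_iff]
  by_contra h0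
  have hinf := hμ.inf hν
  have hfin : IsFiniteMeasure (μ ⊓ ν) := isFiniteMeasure_of_le μ inf_le_left
  obtain ⟨c, hc⟩ := eq_smul_of_ergodic heμ hinf
    (Measure.absolutelyContinuous_of_le inf_le_left)
  obtain ⟨d, hd⟩ := eq_smul_of_ergodic heν hinf
    (Measure.absolutelyContinuous_of_le inf_le_right)
  -- A nonzero infimum is a multiple of both measures, so the two probability measures are
  -- proportional, hence equal.
  have h1 := hc.symm.trans hd
  have h2 : c = d := by simpa using congrArg (fun m => m univ) h1
  subst h2
  have hc0 : c ≠ 0 := by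
    rintro rfl
    exact h0 (by rw [hc, zero_smul]; rfl)
  have hct : c ≠ ∞ := by
    rintro rfl
    have := measure_ne_top (μ ⊓ ν) univ
    rw [hc] at this
    simp at this
  refine hne (Measure.ext fun s _ => ?_)
  have h3 := congrArg (fun m => m s) h1
  simpa [ENNReal.mul_right_inj hc0 hct] using h3

end InvariantMeasures

/-! ### The invariant core and the smoothing effect of the noise. -/

namespace NoisyUnimodalMap

variable (M : NoisyUnimodalMap)

lemma gap_le_one : M.gap ≤ 1 := by
  have := M.T_c_nonneg
  unfold gap unimodalGap; linarith

lemma s_nonneg {x : ℝ} (hx : x ∈ M.stateSet) : 0 ≤ M.s x := by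
  rcases le_or_gt x 0 with h | h
  · exact (M.s_nonpos x ⟨hx.1, h⟩).ge
  · rcases hx.2.lt_or_eq with h1 | h1
    · exact (M.s_mem x ⟨h, h1⟩).1.le
    · rw [h1]; exact M.s_one.1

lemma T_zero : M.T 0 = 0 := M.unimodal.map_zero

lemma T_add_s_le {x : ℝ} (hx : x ∈ M.stateSet) : M.T x + M.s x ≤ 1 - M.gap / 2 := by
  have hg := M.gap_pos
  have hg1 := M.gap_le_one
  have hΔ : M.gap = 1 - M.T M.c := rfl
  rcases lt_trichotomy x 0 with h | h | h
  · have hx' : x ∈ Ico (-unimodalGap M.T M.c) 0 := ⟨hx.1, h⟩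
    have h1 := M.strictAntiOn_neg.antitoneOn ⟨le_rfl, hx'.1.trans_lt h⟩ hx' hx'.1
    have h2 := M.map_left_lt
    have h3 := M.s_nonpos x ⟨hx.1, h.le⟩
    linarith
  · subst h
    rw [M.T_zero, M.s_nonpos 0 ⟨hx.1, le_rfl⟩]
    linarith
  · have h1 := M.T_le_of_unit ⟨h.le, hx.2⟩
    have h2 := M.s_le ⟨h, hx.2⟩
    linarith

lemma gap_half_mem : 1 - M.gap / 2 ∈ Ioo (0 : ℝ) 1 := by
  have hg := M.gap_pos
  have hg1 := M.gap_le_one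
  constructor <;> linarith

/-- The points of the interval `[a, 1 - Γ / 2]`, as a set of states. -/
def core (a : ℝ) : Set M.State := {x | (x : ℝ) ∈ Icc a (1 - M.gap / 2)}

lemma isClosed_core (a : ℝ) : IsClosed (M.core a) := isClosed_Icc.preimage continuous_subtype_val

lemma measurableSet_core (a : ℝ) : MeasurableSet (M.core a) := (M.isClosed_core a).measurableSet

/-- `[a, 1 - Γ / 2]` is a nondegenerate interval in `(0, 1)` that the chain does not leave, and
between `0` and `a` the chain moves to the right. -/
structure IsCore (a : ℝ) : Prop where
  pos : 0 < a
  lt : a < 1 - M.gap / 2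
  lt_sub : ∀ x ∈ Ioo 0 a, x < M.T x - M.s x
  le_sub : ∀ x ∈ Icc a (1 - M.gap / 2), a ≤ M.T x - M.s x

lemma continuousOn_T : ContinuousOn M.T (Ioo 0 1) :=
  M.unimodal.contDiffOn.continuousOn.mono Ioo_subset_Icc_self

/-- Fix `d` in the zone near `0` where the chain moves right. On the compact `[d, 1 - Γ / 2]` the
function `T - s` has a positive minimum, and `a` is the smaller of `d` and this minimum; points of
`[a, d)` move right anyway. -/
lemma exists_isCore : ∃ a, M.IsCore a := by
  obtain ⟨δ, hδ, hlt⟩ := M.sub_gt_near_zero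
  have hb := M.gap_half_mem
  set b := 1 - M.gap / 2 with hbdef
  set d := min δ b / 2 with hd
  have hd0 : 0 < d := by have := lt_min hδ hb.1; positivity
  have hdδ : d < δ := by have := min_le_left δ b; have := lt_min hδ hb.1; linarith
  have hdb : d < b := by have := min_le_right δ b; have := lt_min hδ hb.1; linarith
  have hcont : ContinuousOn (fun x => M.T x - M.s x) (Icc d b) :=
    (M.continuousOn_T.sub M.s_continuousOn).mono fun x hx =>
      ⟨hd0.trans_le hx.1, hx.2.trans_lt hb.2⟩
  obtain ⟨x₀, hx₀, hmin⟩ := isCompact_Icc.exists_isMinOn ⟨d, le_rfl, hdb.le⟩ hcont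
  have hm : 0 < M.T x₀ - M.s x₀ := M.sub_pos x₀ ⟨hd0.trans_le hx₀.1, hx₀.2⟩
  refine ⟨min d (M.T x₀ - M.s x₀), lt_min hd0 hm, (min_le_left _ _).trans_lt hdb,
    fun x hx => hlt x ⟨hx.1, hx.2.trans_le (min_le_left _ _) |>.trans hdδ⟩, fun x hx => ?_⟩
  rcases lt_or_ge x d with h | h
  · exact hx.1.trans (hlt x ⟨(lt_min hd0 hm).trans_le hx.1, h.trans hdδ⟩).le
  · exact (min_le_right _ _).trans (hmin ⟨h, hx.2⟩)

lemma transition_apply (x : M.State) {A : Set M.State} (hA : MeasurableSet A) :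
    M.transition x A = M.transitionReal x (Subtype.val '' A) :=
  Kernel.comapRight_apply' _ _ _ hA

lemma measurableSet_image_val {A : Set M.State} (hA : MeasurableSet A) :
    MeasurableSet (Subtype.val '' A : Set ℝ) :=
  M.measurableSet_stateSet.subtype_image hA

/-- From `x` the chain moves into `[T x - s x, T x + s x]`. -/
lemma transition_eq_zero (x : M.State) {A : Set M.State} (hA : MeasurableSet A)
    (h : ∀ y ∈ A, (y : ℝ) ∉ Icc (M.T x - M.s x) (M.T x + M.s x)) : M.transition x A = 0 := by
  rw [M.transition_apply x hA]
  have hs0 := M.s_nonneg x.2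
  by_cases hs : 0 < M.s x
  · rw [M.transitionReal_of_pos hs, withDensity_apply _ (M.measurableSet_image_val hA)]
    refine setLIntegral_eq_zero (M.measurableSet_image_val hA) ?_
    rintro _ ⟨y, hy, rfl⟩
    simp only [density, Pi.zero_apply]
    rw [M.g_support x (M.mem_Ioc_of_s_pos x.2 hs) hs, ENNReal.ofReal_zero]
    exact fun hmem => h y hy ⟨by linarith [hmem.1], by linarith [hmem.2]⟩
  · rw [M.transitionReal_of_not_pos hs, Measure.dirac_apply' _ (M.measurableSet_image_val hA)]
    refine indicator_of_notMem ?_ _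
    rintro ⟨y, hy, hyx⟩
    exact h y hy (hyx ▸ ⟨by linarith, by linarith⟩)

instance : IsFiniteMeasure M.leb := by
  refine ⟨?_⟩
  rw [leb, comap_subtype_coe_apply M.measurableSet_stateSet, image_univ, Subtype.range_coe]
  exact measure_Icc_lt_top

lemma leb_apply (A : Set M.State) : M.leb A = volume (Subtype.val '' A : Set ℝ) :=
  comap_subtype_coe_apply M.measurableSet_stateSet _ _

lemma leb_countable {A : Set M.State} (hA : A.Countable) : M.leb A = 0 := by
  rw [M.leb_apply]
  exact (hA.image _).measure_zero _

lemma leb_core_pos {a : ℝ} (ha : M.IsCore a) : M.leb (M.core a) ≠ 0 := by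
  have himg : Subtype.val '' M.core a = Icc a (1 - M.gap / 2) := by
    ext y
    simp only [core, mem_image, mem_ofPred_eq, Subtype.exists, exists_and_left, exists_prop,
      exists_eq_right_right, and_iff_left_iff_imp]
    intro hy
    have := M.gap_pos
    exact ⟨by linarith [ha.pos, hy.1], hy.2.trans M.gap_half_mem.2.le⟩
  rw [M.leb_apply, himg, Real.volume_Icc, Ne, ENNReal.ofReal_eq_zero, not_le]
  linarith [ha.lt]

variable {M}

lemma mem_Ioo_of_mem_core {a : ℝ} (ha : M.IsCore a) {x : M.State} (hx : x ∈ M.core a) :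
    (x : ℝ) ∈ Ioo (0 : ℝ) 1 :=
  ⟨ha.pos.trans_le hx.1, hx.2.trans_lt M.gap_half_mem.2⟩

lemma transition_compl_core {a : ℝ} (ha : M.IsCore a) {x : M.State} (hx : x ∈ M.core a) :
    M.transition x (M.core a)ᶜ = 0 :=
  M.transition_eq_zero x (M.measurableSet_core a).compl fun _ hy hmem =>
    hy ⟨(ha.le_sub x hx).trans hmem.1, hmem.2.trans (M.T_add_s_le x.2)⟩

lemma measure_eq_lintegral {μ : Measure M.State} (hμ : Kernel.Invariant M.transition μ)
    {A : Set M.State} (hA : MeasurableSet A) : μ A = ∫⁻ x, M.transition x A ∂μ := by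
  conv_lhs => rw [← hμ.def]
  rw [Measure.bind_apply hA (Kernel.aemeasurable _)]

/-- A stationary measure without an atom at `0` is concentrated on `[a, 1 - Γ / 2]`. -/
lemma measure_compl_core {a : ℝ} (ha : M.IsCore a) {μ : Measure M.State} [IsProbabilityMeasure μ]
    (hμ : Kernel.Invariant M.transition μ) (h0 : μ {x | (x : ℝ) = 0} = 0) :
    μ (M.core a)ᶜ = 0 := by
  have hval : Measurable (Subtype.val : M.State → ℝ) := measurable_subtype_coe
  have hup : μ {x | 1 - M.gap / 2 < (x : ℝ)} = 0 := by
    have hm : MeasurableSet {x : M.State | 1 - M.gap / 2 < (x : ℝ)} := hval measurableSet_Ioi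
    rw [measure_eq_lintegral hμ hm, lintegral_eq_zero_iff (Kernel.measurable_coe _ hm)]
    exact .of_forall fun x => M.transition_eq_zero x hm fun y hy hmem =>
      absurd (hmem.2.trans (M.T_add_s_le x.2)) (not_le.mpr hy)
  have hneg : μ {x | (x : ℝ) < 0} = 0 := by
    have hm : MeasurableSet {x : M.State | (x : ℝ) < 0} := hval measurableSet_Iio
    rw [measure_eq_lintegral hμ hm, lintegral_eq_zero_iff (Kernel.measurable_coe _ hm)]
    have hup' : ∀ᵐ x : M.State ∂μ, ¬ (1 - M.gap / 2 < (x : ℝ)) := measure_eq_zero_iff_ae_notMem.mp hup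
    filter_upwards [hup'] with x hx
    refine M.transition_eq_zero x hm fun y hy hmem => absurd hmem.1 (not_le.mpr ?_)
    refine lt_of_lt_of_le hy ?_
    rcases lt_trichotomy (x : ℝ) 0 with h | h | h
    · rw [M.s_nonpos x ⟨x.2.1, h.le⟩, sub_zero]
      exact (M.pos_of_neg x ⟨x.2.1, h⟩).le
    · rw [M.s_nonpos x ⟨x.2.1, h.le⟩, h, M.T_zero, sub_zero]
    · exact (M.sub_pos x ⟨h, not_lt.mp hx⟩).le
  have hsmall : μ {x | (x : ℝ) ∈ Ioo 0 a} = 0 := by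
    refine measure_null_of_locally_null _ fun x hx => ?_
    -- The threshold `t` separates `x` from all its images, and by continuity points near `x` from
    -- theirs. Outside `(0, min t a)`, almost no point can enter this interval, while those near `x`
    -- in `(0, a)` leave it at once.
    obtain ⟨t, hxt, htf⟩ := exists_between (ha.lt_sub x hx)
    have hx1 : (x : ℝ) ∈ Ioo (0 : ℝ) 1 :=
      ⟨hx.1, hx.2.trans (ha.lt.trans M.gap_half_mem.2)⟩
    have hcont : ContinuousAt (fun y : M.State => M.T y - M.s y) x := by
      have h1 : ContinuousAt (fun y => M.T y - M.s y) (x : ℝ) :=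
        (M.continuousOn_T.sub M.s_continuousOn).continuousAt (isOpen_Ioo.mem_nhds hx1)
      exact h1.comp continuous_subtype_val.continuousAt
    have hU : ∀ᶠ y : M.State in nhds x, (y : ℝ) < t ∧ t < M.T y - M.s y :=
      (continuous_subtype_val.continuousAt.eventually_lt continuousAt_const hxt).and
        (continuousAt_const.eventually_lt hcont htf)
    set A : Set M.State := {y | (y : ℝ) ∈ Ioo 0 (min t a)} with hA
    have hAm : MeasurableSet A := hval measurableSet_Ioo
    have hretreat : ∀ᵐ y ∂μ, y ∉ A → M.transition y A = 0 := by
      have h1 : ∀ᵐ y : M.State ∂μ, ¬ (1 - M.gap / 2 < (y : ℝ)) := measure_eq_zero_iff_ae_notMem.mp hup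
      have h2 : ∀ᵐ y : M.State ∂μ, ¬ ((y : ℝ) < 0) := measure_eq_zero_iff_ae_notMem.mp hneg
      have h3 : ∀ᵐ y : M.State ∂μ, ¬ ((y : ℝ) = 0) := measure_eq_zero_iff_ae_notMem.mp h0
      filter_upwards [h1, h2, h3] with y hy1 hy2 hy3 hyA
      have hy0 : 0 < (y : ℝ) := lt_of_le_of_ne (not_lt.mp hy2) (Ne.symm hy3)
      have hyt : min t a ≤ y := by
        by_contra hlt
        exact hyA ⟨hy0, not_le.mp hlt⟩
      refine M.transition_eq_zero y hAm fun z hz hmem => absurd hmem.1 (not_le.mpr ?_)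
      refine hz.2.trans_le ?_
      rcases lt_or_ge (y : ℝ) a with h | h
      · exact hyt.trans (ha.lt_sub y ⟨hy0, h⟩).le
      · exact (min_le_right _ _).trans (ha.le_sub y ⟨h, not_lt.mp hy1⟩)
    have hle : ∫⁻ y, M.transition y A ∂μ ≤ ∫⁻ y, A.indicator (fun y => M.transition y A) y ∂μ := by
      refine lintegral_mono_ae ?_
      filter_upwards [hretreat] with y hy
      by_cases hyA : y ∈ A
      · simp [hyA]
      · simp [hyA, hy hyA]
    -- Stationarity reads `μ A ≤ ∫ y in A, P_y(A)`, so almost every point of `A` stays in `A` with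
    -- probability one.
    rw [← measure_eq_lintegral hμ hAm, lintegral_indicator hAm] at hle
    have hone : ∫⁻ y in A, (1 - M.transition y A) ∂μ = 0 := by
      rw [lintegral_sub (Kernel.measurable_coe _ hAm)
        (((setLIntegral_mono measurable_const fun y _ => prob_le_one).trans_lt (by
          simp)).ne) (.of_forall fun y => prob_le_one)]
      simp only [lintegral_const, Measure.restrict_apply_univ, one_mul]
      exact tsub_eq_zero_of_le hle
    rw [lintegral_eq_zero_iff (f := fun y => 1 - M.transition y A) (measurable_const.sub (Kernel.measurable_coe _ hAm)),
      Filter.EventuallyEq, ae_restrict_iff' hAm] at hone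
    refine ⟨{y | ((y : ℝ) < t ∧ t < M.T y - M.s y) ∧ (y : ℝ) ∈ Ioo 0 a}, ?_, ?_⟩
    · exact Filter.inter_mem (mem_nhdsWithin_of_mem_nhds hU) self_mem_nhdsWithin
    · refine measure_eq_zero_iff_ae_notMem.mpr ?_
      filter_upwards [hone] with y hy hmem
      have hyA : y ∈ A := ⟨hmem.2.1, lt_min hmem.1.1 hmem.2.2⟩
      have h1 := hy hyA
      rw [M.transition_eq_zero y hAm fun z hz hz2 => absurd hz2.1 (not_le.mpr
        ((hz.2.trans_le (min_le_left _ _)).trans hmem.1.2))] at h1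
      simp at h1
  have hsub : (M.core a)ᶜ ⊆ {x | 1 - M.gap / 2 < (x : ℝ)} ∪ {x | (x : ℝ) < 0} ∪
      {x | (x : ℝ) ∈ Ioo 0 a} ∪ {x | (x : ℝ) = 0} := by
    intro x hx
    by_contra hn
    simp only [mem_union, mem_ofPred_eq, not_or, not_lt, mem_Ioo, not_and] at hn
    obtain ⟨⟨⟨h1, h2⟩, h3⟩, h4⟩ := hn
    exact hx ⟨h3 (lt_of_le_of_ne h2 (Ne.symm h4)), h1⟩
  exact measure_mono_null hsub
    (measure_union_null (measure_union_null (measure_union_null hup hneg) hsmall) h0)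

/-- On the core the noise densities are bounded and have bounded variation, uniformly. -/
lemma exists_bound {a : ℝ} (ha : M.IsCore a) :
    ∃ C : ℝ≥0, ∀ x ∈ M.core a, eVariationOn (M.g x) univ ≤ C ∧
      ∀ y, 0 ≤ M.g x y ∧ M.g x y ≤ C := by
  have hg := M.gap_pos
  obtain ⟨C, hC⟩ := M.g_variation (min a (M.gap / 2)) (lt_min ha.pos (by linarith))
  refine ⟨C, fun x hx => ?_⟩
  have hvar := hC x ⟨(min_le_left _ _).trans hx.1,
    hx.2.trans (by linarith [min_le_right a (M.gap / 2)])⟩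
  have hx1 := mem_Ioo_of_mem_core ha hx
  have hs := (M.s_mem x hx1).1
  have hx2 : (x : ℝ) ∈ Ioc (0 : ℝ) 1 := ⟨hx1.1, hx1.2.le⟩
  refine ⟨hvar, fun y => ⟨M.g_nonneg x hx2 hs y, ?_⟩⟩
  -- A function that vanishes somewhere is bounded by its variation; `s x + 1` is a point outside
  -- the support.
  have h0 : M.g x (M.s x + 1) = 0 := M.g_support x hx2 hs _ fun h => by linarith [h.2]
  have h1 := (eVariationOn.edist_le (M.g x) (mem_univ y) (mem_univ (M.s x + 1))).trans hvar
  rw [h0, edist_nndist, ENNReal.coe_le_coe, ← NNReal.coe_le_coe, coe_nndist, Real.dist_eq,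
    sub_zero] at h1
  exact (le_abs_self _).trans h1

lemma transition_apply_of_pos {x : M.State} (hs : 0 < M.s x) {A : Set M.State}
    (hA : MeasurableSet A) : M.transition x A = ∫⁻ y in A, M.density x y ∂M.leb := by
  rw [M.transition_apply x hA, M.transitionReal_of_pos hs,
    withDensity_apply _ (M.measurableSet_image_val hA), leb,
    setLIntegral_subtype M.measurableSet_stateSet A (M.density x)]

/-- The domination that the abstract results need: densities are bounded by `C` and no mass leaves
the core. -/
lemma exists_transition_le {a : ℝ} (ha : M.IsCore a) : ∃ C : ℝ≥0, ∀ x ∈ M.core a,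
    M.transition x ≤ (C : ℝ≥0∞) • M.leb.restrict (M.core a) := by
  obtain ⟨C, hC⟩ := exists_bound ha
  refine ⟨C, fun x hx => Measure.le_iff.mpr fun A hA => ?_⟩
  have hs := (M.s_mem x (mem_Ioo_of_mem_core ha hx)).1
  have hcm := M.measurableSet_core a
  calc M.transition x A ≤ M.transition x (A ∩ M.core a) + M.transition x (M.core a)ᶜ := by
        refine (measure_mono fun y hy => ?_).trans (measure_union_le _ _)
        by_cases h : y ∈ M.core a
        · exact Or.inl ⟨hy, h⟩
        · exact Or.inr h
    _ = ∫⁻ y in A ∩ M.core a, M.density x y ∂M.leb := by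
        rw [transition_compl_core ha hx, add_zero, transition_apply_of_pos hs (hA.inter hcm)]
    _ ≤ ∫⁻ _ in A ∩ M.core a, C ∂M.leb := by
        refine lintegral_mono fun y => ?_
        rw [density, ← ENNReal.ofReal_coe_nnreal]
        exact ENNReal.ofReal_le_ofReal ((hC x hx).2 _).2
    _ = ((C : ℝ≥0∞) • M.leb.restrict (M.core a)) A := by
        simp [Measure.restrict_apply hA]

/-- A stationary measure that is concentrated on the core has a density of bounded variation. -/
lemma exists_isBVDensity {a : ℝ} (ha : M.IsCore a) {μ : Measure M.State} [IsProbabilityMeasure μ]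
    (hμ : Kernel.Invariant M.transition μ) (h0 : μ (M.core a)ᶜ = 0) :
    ∃ h, M.IsBVDensity μ h := by
  obtain ⟨C, hC⟩ := exists_bound ha
  have hae : ∀ᵐ x ∂μ, x ∈ M.core a := by
    filter_upwards [measure_eq_zero_iff_ae_notMem.mp h0] with x hx using not_not.mp hx
  have hmeas : ∀ y : ℝ, Measurable fun x : M.State => M.g x (y - M.T x) := fun y =>
    M.g_measurable.comp (measurable_subtype_coe.prodMk (measurable_const.sub M.measurable_T))
  have hint : ∀ y : ℝ, Integrable (fun x : M.State => M.g x (y - M.T x)) μ := fun y => by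
    refine .of_bound (hmeas y).aestronglyMeasurable C ?_
    filter_upwards [hae] with x hx
    rw [Real.norm_eq_abs, abs_of_nonneg ((hC x hx).2 _).1]
    exact ((hC x hx).2 _).2
  have hnn : ∀ y : ℝ, 0 ≤ᵐ[μ] fun x : M.State => M.g x (y - M.T x) := fun y => by
    filter_upwards [hae] with x hx using ((hC x hx).2 _).1
  refine ⟨fun y => ∫ x, M.g x (y - M.T x) ∂μ, fun y => integral_nonneg_of_ae (hnn y), ?_, ?_⟩
  -- A variation sum of the averaged density is at most the `μ`-average of those of the translates
  -- of `g x`, and translation does not change the variation.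
  · refine ne_top_of_le_ne_top (ENNReal.coe_ne_top (r := C)) (iSup_le ?_)
    rintro ⟨n, u, hu, -⟩
    simp only
    calc ∑ i ∈ Finset.range n, edist (∫ x, M.g x ((u (i + 1) : ℝ) - M.T x) ∂μ)
            (∫ x, M.g x ((u i : ℝ) - M.T x) ∂μ)
        ≤ ∑ i ∈ Finset.range n, ∫⁻ x : M.State,
            edist (M.g x ((u (i + 1) : ℝ) - M.T x)) (M.g x ((u i : ℝ) - M.T x)) ∂μ := by
          refine Finset.sum_le_sum fun i _ => ?_
          rw [edist_eq_enorm_sub, ← integral_sub (hint (u (i + 1))) (hint (u i))]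
          simp_rw [edist_eq_enorm_sub]
          exact enorm_integral_le_lintegral_enorm _
      _ = ∫⁻ x : M.State, ∑ i ∈ Finset.range n,
            edist (M.g x ((u (i + 1) : ℝ) - M.T x)) (M.g x ((u i : ℝ) - M.T x)) ∂μ := by
          rw [lintegral_finsetSum _ fun i _ => (hmeas _).edist (hmeas _)]
      _ ≤ ∫⁻ _, C ∂μ := by
          refine lintegral_mono_ae ?_
          filter_upwards [hae] with x hx
          refine le_trans ?_ (hC x hx).1
          exact eVariationOn.sum_le (f := M.g x) (u := fun i => (u i : ℝ) - M.T x)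
            (fun i j hij => by
              have h1 : (u i : ℝ) ≤ u j := hu hij
              simpa using h1) fun _ => mem_univ _
      _ = C := by simp
  · ext A hA
    rw [measure_eq_lintegral hμ hA, withDensity_apply _ hA]
    have hdm : Measurable (Function.uncurry fun (x : M.State) (y : M.State) => M.density x y) :=
      M.measurable_density.comp (measurable_fst.prodMk (measurable_subtype_coe.comp measurable_snd))
    calc ∫⁻ x, M.transition x A ∂μ = ∫⁻ x, ∫⁻ y in A, M.density x y ∂M.leb ∂μ := by
          refine lintegral_congr_ae ?_
          filter_upwards [hae] with x hx
          exact transition_apply_of_pos (M.s_mem x (mem_Ioo_of_mem_core ha hx)).1 hA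
      _ = ∫⁻ y in A, ∫⁻ x, M.density x y ∂μ ∂M.leb := lintegral_lintegral_swap hdm.aemeasurable
      _ = ∫⁻ y in A, ENNReal.ofReal (∫ x, M.g x (y - M.T x) ∂μ) ∂M.leb := by
          refine lintegral_congr fun y => ?_
          rw [ofReal_integral_eq_lintegral_ofReal (hint _) (hnn _)]
          rfl

end NoisyUnimodalMap

/-! ### Functions of bounded variation as differences of monotone functions. -/

lemma BoundedVariationOn.exists_monotone_sub_monotone {α : Type*} [LinearOrder α] {h : α → ℝ}
    (hh : BoundedVariationOn h univ) : ∃ p q : α → ℝ, Monotone p ∧ Monotone q ∧ h = p - q := by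
  obtain ⟨p, q, hp, hq, e⟩ := hh.locallyBoundedVariationOn.exists_monotoneOn_sub_monotoneOn
  exact ⟨p, q, monotoneOn_univ.mp hp, monotoneOn_univ.mp hq, e⟩

lemma BoundedVariationOn.countable_not_continuousAt {α : Type*} [LinearOrder α]
    [TopologicalSpace α] [OrderTopology α] [SecondCountableTopology α] {h : α → ℝ}
    (hh : BoundedVariationOn h univ) : {x | ¬ ContinuousAt h x}.Countable := by
  obtain ⟨p, q, hp, hq, rfl⟩ := hh.exists_monotone_sub_monotone
  refine (hp.countable_not_continuousAt.union hq.countable_not_continuousAt).mono fun x hx => ?_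
  by_contra hn
  simp only [mem_union, mem_ofPred_eq, not_or, not_not] at hn
  exact hx (hn.1.sub hn.2)

/-! ### Ergodic measures with a density of bounded variation: singularity, existence, finiteness. -/

namespace NoisyUnimodalMap

variable {M : NoisyUnimodalMap}

instance : OrderTopology M.State :=
  haveI : M.stateSet.OrdConnected := ordConnected_Icc
  inferInstance

lemma IsBVDensity.measurable {μ : Measure M.State} {h : M.State → ℝ} (hh : M.IsBVDensity μ h) :
    Measurable h := by
  obtain ⟨p, q, hp, hq, e⟩ := hh.2.1.exists_monotone_sub_monotone
  rw [e]
  exact hp.measurable.sub hq.measurable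

lemma IsBVDensity.absolutelyContinuous {μ : Measure M.State} {h : M.State → ℝ}
    (hh : M.IsBVDensity μ h) : μ ≪ M.leb := by
  rw [hh.2.2]
  exact withDensity_absolutelyContinuous _ _

lemma IsBVDensity.measure_eq_zero_iff {μ : Measure M.State} {h : M.State → ℝ}
    (hh : M.IsBVDensity μ h) (A : Set M.State) : μ A = 0 ↔ M.leb ({x | h x ≠ 0} ∩ A) = 0 := by
  have he : {x | ENNReal.ofReal (h x) ≠ 0} = {x | h x ≠ 0} := by
    ext x
    simp only [mem_ofPred_eq, ne_eq, ENNReal.ofReal_eq_zero, not_le]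
    exact ⟨fun h1 => h1.ne', fun h1 => lt_of_le_of_ne (hh.1 x) (Ne.symm h1)⟩
  conv_lhs => rw [hh.2.2]
  rw [withDensity_apply_eq_zero hh.measurable.ennreal_ofReal, he]

lemma IsBVDensity.leb_ne_zero_and_ne_zero {μ ν : Measure M.State} {h k : M.State → ℝ}
    (hh : M.IsBVDensity μ h) (hk : M.IsBVDensity ν k) (hs : μ ⟂ₘ ν) :
    M.leb {x | h x ≠ 0 ∧ k x ≠ 0} = 0 := by
  obtain ⟨N, -, h1, h2⟩ := hs
  refine measure_mono_null (fun x hx => ?_) (measure_union_null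
    ((hh.measure_eq_zero_iff N).mp h1) ((hk.measure_eq_zero_iff Nᶜ).mp h2))
  by_cases hxN : x ∈ N
  · exact Or.inl ⟨hx.1, hxN⟩
  · exact Or.inr ⟨hx.2, hxN⟩

/-- Having a density rules out the atom at the fixed point `0`, the only obstruction to living on
the core. -/
lemma measure_compl_core_of_mem {a : ℝ} (ha : M.IsCore a) {μ : Measure M.State}
    (hμ : μ ∈ M.ergodicBV) : μ (M.core a)ᶜ = 0 := by
  obtain ⟨hp, hinv, -, h, hh⟩ := hμ
  refine measure_compl_core ha hinv (hh.absolutelyContinuous (M.leb_countable ?_))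
  exact (countable_singleton (0 : ℝ)).preimage Subtype.val_injective

lemma absolutelyContinuous_restrict_core {a : ℝ} (ha : M.IsCore a) {μ : Measure M.State}
    (hμ : μ ∈ M.ergodicBV) : μ ≪ M.leb.restrict (M.core a) := by
  have h0 := measure_compl_core_of_mem ha hμ
  obtain ⟨-, -, -, h, hh⟩ := hμ
  have h1 : μ.restrict (M.core a) = μ :=
    Measure.restrict_eq_self_of_ae_mem (mem_ae_iff.mpr h0)
  rw [← h1]
  exact hh.absolutelyContinuous.restrict _

lemma mutuallySingular_of_mem {μ ν : Measure M.State} (hμ : μ ∈ M.ergodicBV)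
    (hν : ν ∈ M.ergodicBV) (hne : μ ≠ ν) : μ ⟂ₘ ν := by
  obtain ⟨hpμ, hiμ, heμ, -⟩ := hμ
  obtain ⟨hpν, hiν, heν, -⟩ := hν
  exact mutuallySingular_of_ergodic hiμ hiν heμ heν hne

lemma ae_transition_le {a : ℝ} {C : ℝ≥0∞}
    (hC : ∀ x ∈ M.core a, M.transition x ≤ C • M.leb.restrict (M.core a)) :
    ∀ᵐ x ∂(M.leb.restrict (M.core a)), M.transition x ≤ C • M.leb.restrict (M.core a) :=
  (ae_restrict_iff' (M.measurableSet_core a)).mpr (.of_forall hC)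

lemma ergodicBV_nonempty (M : NoisyUnimodalMap) : M.ergodicBV.Nonempty := by
  obtain ⟨a, ha⟩ := M.exists_isCore
  obtain ⟨C, hC⟩ := exists_transition_le ha
  have hm : M.leb.restrict (M.core a) ≠ 0 := by
    rw [Ne, Measure.restrict_eq_zero]
    exact M.leb_core_pos ha
  obtain ⟨μ, hp, hac, hinv, hext⟩ :=
    exists_extremal_of_le_smul hm ENNReal.coe_ne_top (ae_transition_le hC)
  have h0 : μ (M.core a)ᶜ = 0 := hac (by
    rw [Measure.restrict_apply (M.measurableSet_core a).compl, compl_inter_self, measure_empty])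
  exact ⟨μ, hp, hinv, ergodic_of_extremal hinv hext, exists_isBVDensity ha hinv h0⟩

/-- The sets where the densities are nonzero are disjoint up to null sets and, since each measure is
at most `C` times Lebesgue measure, have measure at least `C⁻¹`; the state space has finite measure.
-/
lemma ergodicBV_finite (M : NoisyUnimodalMap) : M.ergodicBV.Finite := by
  obtain ⟨a, ha⟩ := M.exists_isCore
  obtain ⟨C, hC⟩ := exists_transition_le ha
  choose d hd using fun μ : M.ergodicBV => μ.2.2.2.2
  have hfin := Measure.finite_const_le_meas_of_disjoint_iUnion₀ M.leb (ε := (C : ℝ≥0∞)⁻¹)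
    (As := fun μ : M.ergodicBV => {x | d μ x ≠ 0}) (by simp)
    (fun μ => ((hd μ).measurable (measurableSet_singleton 0).compl).nullMeasurableSet)
    (fun μ ν hne => (hd μ).leb_ne_zero_and_ne_zero (hd ν)
      (mutuallySingular_of_mem μ.2 ν.2 (Subtype.coe_injective.ne hne)))
    (measure_ne_top _ _)
  have huniv : {μ : M.ergodicBV | (C : ℝ≥0∞)⁻¹ ≤ M.leb {x | d μ x ≠ 0}} = univ := by
    refine eq_univ_of_forall fun μ => ?_
    have hp : IsProbabilityMeasure (μ : Measure M.State) := μ.2.1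
    have hle := bind_le_smul (absolutelyContinuous_restrict_core ha μ.2) (ae_transition_le hC)
    rw [μ.2.2.1.def] at hle
    have hm : MeasurableSet {x | d μ x ≠ 0} := (hd μ).measurable (measurableSet_singleton 0).compl
    have h1 : (μ : Measure M.State) {x | d μ x ≠ 0} = 1 := by
      rw [← prob_compl_eq_zero_iff hm, (hd μ).measure_eq_zero_iff, inter_compl_self,
        measure_empty]
    have h2 := (hle {x | d μ x ≠ 0})
    rw [h1, Measure.smul_apply, smul_eq_mul] at h2
    rw [mem_ofPred_eq, ← one_div]
    exact ENNReal.div_le_of_le_mul' (h2.trans (by gcongr; exact Measure.restrict_le_self))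
  rw [huniv] at hfin
  exact finite_coe_iff.mp (finite_univ_iff.mp hfin)

/-! ### Topological supports under full noise. -/

lemma ne_zero_transition_of_fullNoise (hfull : M.FullNoise) {x : M.State}
    (hx : (x : ℝ) ∈ Ioo (0 : ℝ) 1) {W : Set M.State} (hW : IsOpen W) {y : M.State} (hy : y ∈ W)
    (hyx : (y : ℝ) ∈ Icc (M.T x - M.s x) (M.T x + M.s x)) : M.transition x W ≠ 0 := by
  obtain ⟨V, hV, rfl⟩ := isOpen_induced_iff.mp hW
  have hs := (M.s_mem x hx).1
  have hmem : (y : ℝ) - M.T x ∈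
      (volume.withDensity fun w => ENNReal.ofReal (M.g x w)).support := by
    rw [hfull x hx]
    exact ⟨by linarith [hyx.1], by linarith [hyx.2]⟩
  have hcont : Continuous fun w : ℝ => w + M.T x := by fun_prop
  have hV' : IsOpen ((fun w : ℝ => w + M.T x) ⁻¹' V) := hV.preimage hcont
  have hpos := (Measure.mem_support_iff_forall _).mp hmem _ (hV'.mem_nhds (by simpa using hy))
  rw [withDensity_apply _ hV'.measurableSet, ← lintegral_indicator hV'.measurableSet,
    ← lintegral_sub_right_eq_self _ (M.T x)] at hpos
  intro h0
  rw [M.transition_apply x hW.measurableSet, Subtype.image_preimage_coe] at h0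
  have h1 : M.transitionReal x V = 0 := by
    refine measure_mono_null (fun z hz => ?_)
      (measure_union_null h0 (M.transitionReal_compl x))
    by_cases h : z ∈ M.stateSet
    · exact Or.inl ⟨h, hz⟩
    · exact Or.inr h
  rw [M.transitionReal_of_pos hs, withDensity_apply _ hV.measurableSet,
    ← lintegral_indicator hV.measurableSet] at h1
  refine hpos.ne' (Eq.trans (lintegral_congr fun z => ?_) h1)
  by_cases hz : z ∈ V <;> simp [indicator, hz, density]

/-- With full noise the support of a stationary measure has countable boundary: each of its points
is a limit of points of intervals in the support whose lengths are bounded from below. -/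
lemma countable_support_diff_interior (hfull : M.FullNoise) {a : ℝ} (ha : M.IsCore a)
    {μ : Measure M.State} [IsProbabilityMeasure μ] (hinv : Kernel.Invariant M.transition μ)
    (h0 : μ (M.core a)ᶜ = 0) : (μ.support \ interior μ.support).Countable := by
  have hb := M.gap_half_mem
  obtain ⟨x₀, hx₀, hmin⟩ := isCompact_Icc.exists_isMinOn ⟨a, le_rfl, ha.lt.le⟩
    (M.s_continuousOn.mono fun x (hx : x ∈ Icc a (1 - M.gap / 2)) =>
      ⟨ha.pos.trans_le hx.1, hx.2.trans_lt hb.2⟩)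
  set η := M.s x₀ with hη
  have hη0 : 0 < η := (M.s_mem x₀ ⟨ha.pos.trans_le hx₀.1, hx₀.2.trans_lt hb.2⟩).1
  have hcore : ∀ᵐ x ∂μ, x ∈ M.core a := mem_ae_iff.mpr h0
  have hgood : ∀ᵐ x ∂μ, M.transition x μ.supportᶜ = 0 := by
    have hm : MeasurableSet μ.supportᶜ := Measure.isOpen_compl_support.measurableSet
    have h1 := measure_eq_lintegral hinv hm
    rw [Measure.measure_compl_support] at h1
    exact (lintegral_eq_zero_iff (Kernel.measurable_coe _ hm)).mp h1.symm
  -- Mass near `y` comes from core points `x` whose successors almost surely lie in the closed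
  -- support. By full noise the support contains all of `[T x - s x, T x + s x]`, of length at least
  -- `2 * η`.
  have key : ∀ y ∈ μ.support, ∀ r > 0, ∃ p q : ℝ, p + 2 * η ≤ q ∧
      (∀ z : M.State, (z : ℝ) ∈ Icc p q → z ∈ μ.support) ∧
      ∃ z ∈ Icc p q, |z - (y : ℝ)| < r := by
    intro y hy r hr
    have hUo : IsOpen {z : M.State | |(z : ℝ) - y| < r} :=
      isOpen_lt (by fun_prop) continuous_const
    have hU := (Measure.mem_support_iff_forall y).mp hy _
      (hUo.mem_nhds (by simpa using hr))
    rw [measure_eq_lintegral hinv hUo.measurableSet] at hU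
    have hne : ¬ ∀ᵐ x ∂μ, M.transition x {z : M.State | |(z : ℝ) - y| < r} = 0 := fun h =>
      hU.ne' ((lintegral_eq_zero_iff (Kernel.measurable_coe _ hUo.measurableSet)).mpr h)
    obtain ⟨x, hxU, hxc, hxg⟩ := ((Filter.not_eventually.mp hne).and_eventually
      (hcore.and hgood)).exists
    refine ⟨M.T x - M.s x, M.T x + M.s x, ?_, fun z hz => ?_, ?_⟩
    · have : η ≤ M.s x := hmin hxc
      linarith
    · by_contra hzs
      exact ne_zero_transition_of_fullNoise hfull (mem_Ioo_of_mem_core ha hxc)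
        Measure.isOpen_compl_support hzs hz hxg
    · by_contra! hcon
      exact hxU (M.transition_eq_zero x hUo.measurableSet fun z hz hz2 =>
        absurd hz (not_lt.mpr (hcon z hz2)))
  have hint : ∀ p q : ℝ, (∀ z : M.State, (z : ℝ) ∈ Icc p q → z ∈ μ.support) →
      ∀ z : M.State, (z : ℝ) ∈ Ioo p q → z ∈ interior μ.support := fun p q hpq z hz =>
    mem_interior.mpr ⟨Subtype.val ⁻¹' Ioo p q, fun w hw => hpq w (Ioo_subset_Icc_self hw),
      isOpen_Ioo.preimage continuous_subtype_val, hz⟩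
  refine Countable.mono (fun y hy => ?_)
    ((countable_setOfPred_isolated_right_within (s := μ.support \ interior μ.support)).union
      (countable_setOfPred_isolated_left_within (s := μ.support \ interior μ.support)))
  -- If such intervals begin at or arbitrarily close to the right of `y`, their interiors cover `(y,
  -- y + 2 * η)`. Otherwise the intervals near `y` end at or before `y`, which is not interior, and
  -- cover `(y - 2 * η, y)`. So `y` is isolated on one side among the non-interior points, and such
  -- points are countable.
  by_cases hR : ∀ r > 0, ∃ p q : ℝ, p + 2 * η ≤ q ∧
      (∀ z : M.State, (z : ℝ) ∈ Icc p q → z ∈ μ.support) ∧ (y : ℝ) ≤ p ∧ p < y + r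
  · refine Or.inl ⟨hy, ?_⟩
    rw [← Filter.empty_mem_iff_bot, mem_nhdsWithin]
    refine ⟨{z : M.State | (z : ℝ) < y + 2 * η}, isOpen_lt (by fun_prop) continuous_const,
      by simpa using hη0, ?_⟩
    rintro z ⟨hz1, ⟨-, hz2⟩, hz3⟩
    have hyz : (y : ℝ) < z := hz3
    have hz1' : (z : ℝ) < y + 2 * η := hz1
    obtain ⟨p, q, hpq, hsub, h1, h2⟩ := hR (z - y) (by linarith)
    exact hz2 (hint p q hsub z ⟨by linarith, by linarith⟩)
  · push Not at hR
    obtain ⟨r₀, hr₀, hR⟩ := hR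
    refine Or.inr ⟨hy, ?_⟩
    rw [← Filter.empty_mem_iff_bot, mem_nhdsWithin]
    refine ⟨{z : M.State | (y : ℝ) - 2 * η < z}, isOpen_lt continuous_const (by fun_prop),
      by simpa using hη0, ?_⟩
    rintro z ⟨hz1, ⟨-, hz2⟩, hz3⟩
    have hyz : (z : ℝ) < y := hz3
    have hz1' : (y : ℝ) - 2 * η < z := hz1
    obtain ⟨p, q, hpq, hsub, w, hw, hwy⟩ := key y hy.1 (min r₀ (y - z))
      (lt_min hr₀ (by linarith))
    have hw1 := abs_lt.mp (hwy.trans_le (min_le_left _ _))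
    have hw2 := abs_lt.mp (hwy.trans_le (min_le_right _ _))
    have hyp : p < y := by
      by_contra h
      have := hR p q hpq hsub (not_lt.mp h)
      linarith [hw.1]
    have hyq : q ≤ y := by
      by_contra h
      exact hy.2 (hint p q hsub y ⟨hyp, not_le.mp h⟩)
    exact hz2 (hint p q hsub z ⟨by linarith, by linarith [hw.2]⟩)

/-- A point of `ν.support` interior to `μ.support` would make `ν` charge that interior, hence give a
continuity point there at which the density of `ν` is nonzero. The density stays nonzero nearby,
where `μ` also has mass, against singularity. What remains of the intersection is countable. -/
lemma leb_support_inter_support (hfull : M.FullNoise) {μ ν : Measure M.State}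
    (hμ : μ ∈ M.ergodicBV) (hν : ν ∈ M.ergodicBV) (hne : μ ≠ ν) :
    M.leb (μ.support ∩ ν.support) = 0 := by
  obtain ⟨a, ha⟩ := M.exists_isCore
  have hsing := mutuallySingular_of_mem hμ hν hne
  have h0 := measure_compl_core_of_mem ha hμ
  obtain ⟨hp, hinv, -, h, hh⟩ := hμ
  obtain ⟨-, -, -, k, hk⟩ := hν
  refine M.leb_countable (Countable.mono (fun y hy => ?_)
    (countable_support_diff_interior hfull ha hinv h0))
  refine ⟨hy.1, fun hyi => ?_⟩
  have hνpos := (Measure.mem_support_iff_forall y).mp hy.2 _ (isOpen_interior.mem_nhds hyi)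
  have hlk : M.leb ({x | k x ≠ 0} ∩ interior μ.support) ≠ 0 := fun h1 =>
    hνpos.ne' ((hk.measure_eq_zero_iff _).mpr h1)
  obtain ⟨z, ⟨hkz, hzi⟩, hzc⟩ : (({x | k x ≠ 0} ∩ interior μ.support) \
      {x | ¬ ContinuousAt k x}).Nonempty := by
    by_contra hemp
    rw [not_nonempty_iff_eq_empty, sdiff_eq_empty] at hemp
    exact hlk (measure_mono_null hemp (M.leb_countable hk.2.1.countable_not_continuousAt))
  have hnhds : {x | k x ≠ 0} ∩ interior μ.support ∈ nhds z :=
    Filter.inter_mem ((not_not.mp hzc).eventually_ne hkz) (isOpen_interior.mem_nhds hzi)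
  have hμpos := (Measure.mem_support_iff_forall z).mp (interior_subset hzi) _ hnhds
  refine hμpos.ne' ((hh.measure_eq_zero_iff _).mpr
    (measure_mono_null (fun x hx => ?_) (hh.leb_ne_zero_and_ne_zero hk hsing)))
  exact ⟨hx.1, hx.2.1⟩

end NoisyUnimodalMap

theorem mainTheorem2 (M : NoisyUnimodalMap) :
    M.ergodicBV.Finite ∧ M.ergodicBV.Nonempty ∧
    (∀ μ ∈ M.ergodicBV, ∀ ν ∈ M.ergodicBV, μ ≠ ν →
      ∀ h k : M.State → ℝ, M.IsBVDensity μ h → M.IsBVDensity ν k →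
        M.leb {x : M.State | h x ≠ 0 ∧ k x ≠ 0} = 0) ∧
    (M.FullNoise → ∀ μ ∈ M.ergodicBV, ∀ ν ∈ M.ergodicBV, μ ≠ ν →
      M.leb (μ.support ∩ ν.support) = 0) ∧
    ∃ ε : ℝ, 0 < ε ∧ ∀ μ ∈ M.ergodicBV,
      μ.support ⊆ {x : M.State | (x : ℝ) ∈ Icc ε (1 - M.gap / 2)} := by
  obtain ⟨a, ha⟩ := M.exists_isCore
  refine ⟨M.ergodicBV_finite, M.ergodicBV_nonempty, fun μ hμ ν hν hne h k hh hk =>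
    hh.leb_ne_zero_and_ne_zero hk (NoisyUnimodalMap.mutuallySingular_of_mem hμ hν hne),
    fun hfull μ hμ ν hν hne => NoisyUnimodalMap.leb_support_inter_support hfull hμ hν hne,
    a, ha.pos, fun μ hμ => ?_⟩
  exact Measure.support_subset_of_isClosed (M.isClosed_core a)
    (mem_ae_iff.mpr (NoisyUnimodalMap.measure_compl_core_of_mem ha hμ))
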